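/- Let $n\ge 2$, $a>0$, $\mathbb{R}^n_+=\{x=(x',x_n): x'\in\mathbb{R}^{n-1},\ x_n>0\}$, let $1<p\le\infty$ and $q=p/(p-1)$ (with $q=1$ if $p=\infty$). For real-valued $g\in L^p(\mathbb{R}^{n-1}\times(0,\infty))$ let $\|g\|_{p,t}$ denote the norm of $g$ in $L^p(\mathbb{R}^{n-1}\times(0,t))$, and let $$u(x,t)=-\frac{2a^2}{(4a^2\pi)^{n/2}}\int_0^t\int_{\mathbb{R}^{n-1}}\frac{e^{-\frac{|x-y|^2}{4a^2(t-\tau)}}}{(t-\tau)^{n/2}}\,g(y',\tau)\,dy'\,d\tau,\qquad y=(y',0),$$ be the heat single-layer potential which represents the solution of the Neumann problem $\partial u/\partial t=a^2\Delta u$ in $\mathbb{R}^n_+\times(0,\infty)$, $u|_{t=0}=0$, $\partial u/\partial x_n|_{x_n=0}=g$. For $\kappa>0$ and $\lambda>-1$ put $\omega_{\kappa,\lambda}(s)=\int_{\kappa/s^2}^\infty \xi^\lambda e^{-\xi}\,d\xi$. Let $\omega_{n-1}$ be the area of the unit sphere in $\mathbb{R}^{n-1}$ and $e_n=(0,\dots,0,1)$.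 Let $(x,t)\in\mathbb{R}^n_+\times(0,\infty)$ be arbitrary. For every such $g$ the integral defining $u(x,t)$ converges absolutely, $u(\cdot,t)$ is differentiable at $x$, and the sharp (that is, least) coefficient $\mathcal{N}_p(x,t)$ in the inequality $$|\nabla_x u(x,t)|\le \mathcal{N}_p(x,t)\,\|g\|_{p,t}\qquad\text{for all } g\in L^p(\mathbb{R}^{n-1}\times(0,\infty))$$ is given by $$\mathcal{N}_p(x,t)=\frac{k_{n,p}}{x_n^{(n+1)/p}}\max_{|z|=1}\left\{\int_{\mathbb{S}^{n-1}}\omega_{\kappa,\lambda}\big((\sigma,e_n)\big)\,|(\sigma,e_n)|^{\frac{n-p+2}{p-1}}\,|(\sigma,z)|^{\frac{p}{p-1}}\,d\sigma\right\}^{\frac{p-1}{p}},$$ where the integrals over the sphere are finite, the maximum is attained, and $$k_{n,p}=\frac{2^{(3-p)/p}a^{2/p}}{\pi^{n/2}q^{\frac n2+\frac1p}},\qquad \kappa=\frac{q x_n^2}{4a^2t},\qquad \lambda=\frac{(n+2)q}{2}-2 .$$ For $p=\infty$ the expressions in $p$ are understood as their limits: the exponents are $-1$, $1$ and $1$ respectively,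 $k_{n,\infty}=\frac1{2\pi^{n/2}}$, and the power of $x_n$ is $1$. If $2\le p\le (n+4)/2$, the maximum is attained at $z=e_n$, and $$\mathcal{N}_p(x,t)=\frac{k_{n,p}}{x_n^{(n+1)/p}}\left\{2\omega_{n-1}\int_0^{\pi/2}\left\{\int_{\frac{q x_n^2}{4a^2t\cos^2\vartheta}}^\infty\xi^{\frac{(n-2)p+4}{2(p-1)}}e^{-\xi}\,d\xi\right\}\cos^{\frac{n+2}{p-1}}\vartheta\,\sin^{n-2}\vartheta\,d\vartheta\right\}^{\frac{p-1}{p}} .$$ In particular, $$\mathcal{N}_2(x,t)=\frac{b_n}{x_n^{(n+1)/2}}\left\{\int_0^{\pi/2}\left\{\int_{\frac{x_n^2}{2a^2t\cos^2\vartheta}}^\infty\xi^{n}e^{-\xi}\,d\xi\right\}\cos^{n+2}\vartheta\,\sin^{n-2}\vartheta\,d\vartheta\right\}^{1/2},\qquad b_n=\frac{a}{2^{\frac{n-2}{2}}\pi^{\frac{n+1}{4}}\sqrt{\Gamma\left(\frac{n-1}{2}\right)}} .$$ -/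

import Mathlib

open MeasureTheory Set
open scoped ENNReal

noncomputable section

/-- The boundary point `y = (y', 0)` of the half-space in `ℝ^(d+1)`, for `y'` in `ℝ^d`. -/
def boundaryPoint {d : ℕ} (y' : EuclideanSpace ℝ (Fin d)) : EuclideanSpace ℝ (Fin (d + 1)) :=
  WithLp.toLp 2 (Fin.snoc (α := fun _ => ℝ) (fun i => y' i) 0)

/-- The unit vector `e_n` in `ℝ^n`, `n = d + 1`, pointing into the half-space. -/
def lastUnitVector (d : ℕ) : EuclideanSpace ℝ (Fin (d + 1)) :=
  EuclideanSpace.single (Fin.last d) (1 : ℝ)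

/-- `exp (-|x - y|² / (4 a² (t - τ))) / (t - τ)^(n/2) * g (y', τ)` with `y = (y', 0)`,
`n = d + 1`, as a function of `w = (y', τ)`. -/
def singleLayerIntegrand {d : ℕ} (a : ℝ) (g : EuclideanSpace ℝ (Fin d) × ℝ → ℝ)
    (x : EuclideanSpace ℝ (Fin (d + 1))) (t : ℝ) (w : EuclideanSpace ℝ (Fin d) × ℝ) : ℝ :=
  Real.exp (-‖x - boundaryPoint w.1‖ ^ 2 / (4 * a ^ 2 * (t - w.2))) /
    (t - w.2) ^ (((d + 1 : ℕ) : ℝ) / 2) * g w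

/-- The heat single-layer potential with Neumann data `g`, in dimension `n = d + 1`. -/
def singleLayer {d : ℕ} (a : ℝ) (g : EuclideanSpace ℝ (Fin d) × ℝ → ℝ)
    (x : EuclideanSpace ℝ (Fin (d + 1))) (t : ℝ) : ℝ :=
  -(2 * a ^ 2 / (4 * a ^ 2 * Real.pi) ^ (((d + 1 : ℕ) : ℝ) / 2)) *
    ∫ w in (univ : Set (EuclideanSpace ℝ (Fin d))) ×ˢ Ioo (0 : ℝ) t,
      singleLayerIntegrand a g x t w

/-- `g` belongs to `L^p(ℝ^d × (0, ∞))`. -/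
def IsBoundaryDatum {d : ℕ} (p : ℝ≥0∞) (g : EuclideanSpace ℝ (Fin d) × ℝ → ℝ) : Prop :=
  MemLp g p (volume.restrict ((univ : Set (EuclideanSpace ℝ (Fin d))) ×ˢ Ioi (0 : ℝ)))

/-- The norm of `g` in `L^p(ℝ^d × (0, t))`. -/
def boundaryNorm {d : ℕ} (p : ℝ≥0∞) (t : ℝ) (g : EuclideanSpace ℝ (Fin d) × ℝ → ℝ) : ℝ :=
  (eLpNorm g p
    (volume.restrict ((univ : Set (EuclideanSpace ℝ (Fin d))) ×ˢ Ioo (0 : ℝ) t))).toReal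

/-- `N` is the sharp (least) coefficient in `|∇_x u(x, t)| ≤ N ‖g‖_{p,t}`, over all data `g` in
`L^p`, where `u` is the single-layer potential of `g`; the potential converges absolutely at
`(x, t)` and is differentiable there in `x`. -/
def IsSharpGradientCoeff {d : ℕ} (a : ℝ) (p : ℝ≥0∞) (x : EuclideanSpace ℝ (Fin (d + 1)))
    (t N : ℝ) : Prop :=
  (∀ g : EuclideanSpace ℝ (Fin d) × ℝ → ℝ, IsBoundaryDatum p g →
    IntegrableOn (singleLayerIntegrand a g x t)
      ((univ : Set (EuclideanSpace ℝ (Fin d))) ×ˢ Ioo (0 : ℝ) t) ∧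
    DifferentiableAt ℝ (fun ξ => singleLayer a g ξ t) x) ∧
  IsLeast {C : ℝ | ∀ g : EuclideanSpace ℝ (Fin d) × ℝ → ℝ, IsBoundaryDatum p g →
    ‖gradient (fun ξ => singleLayer a g ξ t) x‖ ≤ C * boundaryNorm p t g} N

/-- The weight `ω_{κ,λ}(u) = ∫_{κ/u²}^∞ ξ^λ e^{-ξ} dξ`. -/
def gammaWeight (κ lam u : ℝ) : ℝ :=
  ∫ ξ in Ioi (κ / u ^ 2), ξ ^ lam * Real.exp (-ξ)

/-- `ω_{κ,λ}((e_σ, e_n)) |(e_σ, e_n)|^α |(e_σ, z)|^β`. -/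
def sphereIntegrand {d : ℕ} (κ lam α β : ℝ) (z : EuclideanSpace ℝ (Fin (d + 1)))
    (σ : Metric.sphere (0 : EuclideanSpace ℝ (Fin (d + 1))) 1) : ℝ :=
  gammaWeight κ lam (inner ℝ (σ : EuclideanSpace ℝ (Fin (d + 1))) (lastUnitVector d)) *
    |inner ℝ (σ : EuclideanSpace ℝ (Fin (d + 1))) (lastUnitVector d)| ^ α *
    |inner ℝ (σ : EuclideanSpace ℝ (Fin (d + 1))) z| ^ β

/-- Surface (area) measure on the unit sphere of `ℝ^m`. -/
def surfaceMeasure (m : ℕ) : Measure (Metric.sphere (0 : EuclideanSpace ℝ (Fin m)) 1) :=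
  (volume : Measure (EuclideanSpace ℝ (Fin m))).toSphere

/-- The integral of `sphereIntegrand` over the unit sphere, as a function of `z`. -/
def sphereIntegral {d : ℕ} (κ lam α β : ℝ) (z : EuclideanSpace ℝ (Fin (d + 1))) : ℝ :=
  ∫ σ, sphereIntegrand κ lam α β z σ ∂(surfaceMeasure (d + 1))

/-- The area `ω_m` of the unit sphere of `ℝ^m`. -/
def sphereArea (m : ℕ) : ℝ := (surfaceMeasure m).real univ

/-- The constant `k_{n,p}`, with `q = p / (p - 1)`. -/
def kConst (n : ℕ) (a p : ℝ) : ℝ :=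
  2 ^ ((3 - p) / p) * a ^ (2 / p) /
    (Real.pi ^ ((n : ℝ) / 2) * (p / (p - 1)) ^ ((n : ℝ) / 2 + 1 / p))

/-- The constant in the case `p = 2`. -/
def bConst (n : ℕ) (a : ℝ) : ℝ :=
  a / (2 ^ (((n : ℝ) - 2) / 2) * Real.pi ^ (((n : ℝ) + 1) / 4) *
    √(Real.Gamma (((n : ℝ) - 1) / 2)))

end

/-! Differentiation under the integral gives `∇u(x,t) = ∫ g K`, where the vector kernel `K`
(`singleLayerGradKernel`) is a positive multiple of `x - y`. Since `x_n > 0`, Gaussian decay beats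
every negative power of `t - τ`, so `K` lies in every `L^q` and is dominated uniformly near `x`.

The norm of a vector is the supremum of its components along unit vectors `z`. For fixed `z`,
Hölder's inequality gives `‖(z,K)‖_q` as the exact norm of `g ↦ ∫ g (z,K)`, with extremal
`sign(k)|k|^(q-1)`, `k = (z,K)`. Hence the sharp coefficient is `max_z ‖(z,K)‖_q`
(`isSharpGradientCoeff_of_isGreatest`).

In this `L^q` norm, the substitution `ξ = q|x-y|²/(4a²(t-τ))` turns the time integral into an
incomplete Gamma function of the cosine `x_n/|x-y|`. What remains is an integral over a hyperplane
at distance `x_n` of a function of direction times a power of `|x-y|`. Central projection makes it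
half of an integral over the whole sphere, because the integrand is even
(`integral_abs_inner_singleLayerGradKernel`). The maximum over `z` exists by compactness and
dominated convergence.

For `α > 0` the weight `F = ω(u)|u|^α` increases with `|u|`, `u = (σ,e_n)`. Averaging over the
reflection that exchanges `e_n` and `z`, a two-term rearrangement inequality shows that `e_n` is a
maximizer (`isMaxOn_sphereIntegral_lastUnitVector`). There the integrand depends only on the angle
with `e_n`, which leaves a one-dimensional integral. -/

/-- The point of `ℝ^(d+1)` with first coordinates `v` and last coordinate `h`. -/
def snocPoint {d : ℕ} (v : EuclideanSpace ℝ (Fin d)) (h : ℝ) : EuclideanSpace ℝ (Fin (d + 1)) :=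
  WithLp.toLp 2 (Fin.snoc (α := fun _ => ℝ) (fun i => v i) h)

/-! ### Splitting off the last coordinate. -/

section SnocPoint

variable {d : ℕ}

lemma snocPoint_last (v : EuclideanSpace ℝ (Fin d)) (h : ℝ) :
    snocPoint v h (Fin.last d) = h := by
  simp [snocPoint]

lemma snocPoint_castSucc (v : EuclideanSpace ℝ (Fin d)) (h : ℝ) (i : Fin d) :
    snocPoint v h i.castSucc = v i := by
  simp [snocPoint]

lemma smul_snocPoint (c : ℝ) (v : EuclideanSpace ℝ (Fin d)) (h : ℝ) :
    c • snocPoint v h = snocPoint (c • v) (c * h) := by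
  ext i
  refine Fin.lastCases ?_ (fun i => ?_) i
  · simp [snocPoint_last]
  · simp [snocPoint_castSucc]

lemma sub_boundaryPoint (x : EuclideanSpace ℝ (Fin (d + 1))) (y : EuclideanSpace ℝ (Fin d)) :
    x - boundaryPoint y =
      snocPoint (WithLp.toLp 2 (fun i : Fin d => x i.castSucc) - y) (x (Fin.last d)) := by
  ext i
  refine Fin.lastCases ?_ (fun i => ?_) i
  · simp [snocPoint_last, boundaryPoint]
  · simp [snocPoint_castSucc, boundaryPoint]

lemma norm_snocPoint_sq (v : EuclideanSpace ℝ (Fin d)) (h : ℝ) :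
    ‖snocPoint v h‖ ^ 2 = ‖v‖ ^ 2 + h ^ 2 := by
  simp [EuclideanSpace.norm_sq_eq, Fin.sum_univ_castSucc, snocPoint_last, snocPoint_castSucc]

lemma norm_snocPoint (v : EuclideanSpace ℝ (Fin d)) (h : ℝ) :
    ‖snocPoint v h‖ = √(‖v‖ ^ 2 + h ^ 2) := by
  rw [← norm_snocPoint_sq, Real.sqrt_sq (norm_nonneg _)]

lemma continuous_snocPoint :
    Continuous (fun w : EuclideanSpace ℝ (Fin d) × ℝ => snocPoint w.1 w.2) := by
  unfold snocPoint
  refine (PiLp.continuous_toLp 2 _).comp (continuous_pi fun i => ?_)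
  refine Fin.lastCases ?_ (fun i => ?_) i
  · simpa using continuous_snd
  · simp only [Fin.snoc_castSucc]
    fun_prop

lemma inner_lastUnitVector (x : EuclideanSpace ℝ (Fin (d + 1))) :
    inner ℝ x (lastUnitVector d) = x (Fin.last d) := by
  simp [lastUnitVector, EuclideanSpace.inner_single_right]

lemma norm_lastUnitVector : ‖lastUnitVector d‖ = 1 := by
  simp [lastUnitVector]

lemma measurePreserving_snocPoint :
    MeasurePreserving (fun w : EuclideanSpace ℝ (Fin d) × ℝ => snocPoint w.1 w.2)
      (volume.prod volume) volume := by
  have h1 : MeasurePreserving (fun w : EuclideanSpace ℝ (Fin d) × ℝ => (w.2, w.1.ofLp))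
      (volume.prod volume) (volume.prod volume) :=
    ((MeasurePreserving.id _).prod (PiLp.volume_preserving_ofLp (Fin d))).comp
      Measure.measurePreserving_swap
  have h2 := (volume_preserving_piFinSuccAbove (fun _ : Fin (d + 1) => ℝ) (Fin.last d)).symm
  have h3 := (PiLp.volume_preserving_toLp (Fin (d + 1))).comp (h2.comp h1)
  have h4 : (fun w : EuclideanSpace ℝ (Fin d) × ℝ => snocPoint w.1 w.2) =
      WithLp.toLp 2 ∘ (MeasurableEquiv.piFinSuccAbove (fun _ => ℝ) (Fin.last d)).symm ∘
        fun w => (w.2, w.1.ofLp) := by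
    funext w
    simp only [Function.comp, snocPoint]
    congr 1
    funext i
    refine Fin.lastCases ?_ (fun i => ?_) i
    · simp [MeasurableEquiv.piFinSuccAbove, Fin.insertNthEquiv]
    · simp [MeasurableEquiv.piFinSuccAbove, Fin.insertNthEquiv]
  rw [h4]
  exact h3

end SnocPoint

/-! ### Polar coordinates and central projection. -/

section Polar

variable {d : ℕ}

/-- A function homogeneous of degree zero separates from a radial weight in polar coordinates. With
the weight `exp (-r)` the radial factor is finite and nonzero, so identities between volume
integrals can be divided down to the sphere. -/
lemma lintegral_eq_sphere_mul_radial {G : EuclideanSpace ℝ (Fin (d + 1)) → ℝ≥0∞}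
    (hG : Measurable G) (hom : ∀ c : ℝ, c ≠ 0 → ∀ x, G (c • x) = G x)
    {w : ℝ → ℝ≥0∞} (hw : Measurable w) :
    ∫⁻ x, G x * w ‖x‖ = (∫⁻ σ, G σ ∂(surfaceMeasure (d + 1))) *
      ∫⁻ r in Ioi (0 : ℝ), ENNReal.ofReal (r ^ d) * w r := by
  have hmp := (volume :
    Measure (EuclideanSpace ℝ (Fin (d + 1)))).measurePreserving_homeomorphUnitSphereProd
  have h1 := hmp.lintegral_comp_emb (Homeomorph.measurableEmbedding _)
    (fun z : Metric.sphere (0 : EuclideanSpace ℝ (Fin (d + 1))) 1 × Ioi (0 : ℝ) => G z.1 * w z.2)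
  have h0 : ∫⁻ x, G x * w ‖x‖ = ∫⁻ x in ({0}ᶜ : Set (EuclideanSpace ℝ (Fin (d + 1)))), G x * w ‖x‖ := by
    rw [restrict_compl_singleton]
  rw [h0, ← lintegral_subtype_comap (measurableSet_singleton _).compl]
  have hfd : Module.finrank ℝ (EuclideanSpace ℝ (Fin (d + 1))) - 1 = d := by simp
  rw [hfd] at h1
  have h2 : ∀ x : ({0}ᶜ : Set (EuclideanSpace ℝ (Fin (d + 1)))),
      G x * w ‖(x : EuclideanSpace ℝ (Fin (d + 1)))‖ =
      G (homeomorphUnitSphereProd _ x).1 * w (homeomorphUnitSphereProd _ x).2 := by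
    intro x
    have hx : ‖(x : EuclideanSpace ℝ (Fin (d + 1)))‖ ≠ 0 := by
      exact norm_ne_zero_iff.2 x.2
    simp only [homeomorphUnitSphereProd_apply_fst_coe, homeomorphUnitSphereProd_apply_snd_coe]
    rw [hom _ (inv_ne_zero hx)]
  rw [lintegral_congr h2, h1]
  rw [lintegral_prod_mul (f := fun σ : Metric.sphere (0 : EuclideanSpace ℝ (Fin (d + 1))) 1 => G σ)
    (g := fun r : Ioi (0 : ℝ) => w r) (hG.comp measurable_subtype_coe).aemeasurable
    (hw.comp measurable_subtype_coe).aemeasurable]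
  rw [surfaceMeasure]
  congr 1
  rw [Measure.volumeIoiPow, lintegral_withDensity_eq_lintegral_mul _ (by fun_prop) (by fun_prop)]
  exact lintegral_subtype_comap measurableSet_Ioi (fun r => ENNReal.ofReal (r ^ d) * w r)

lemma lintegral_comp_smul_euclidean {m : ℕ} (f : EuclideanSpace ℝ (Fin m) → ℝ≥0∞)
    {c : ℝ} (hc : c ≠ 0) :
    ∫⁻ v, f v = ENNReal.ofReal (|c| ^ m) * ∫⁻ v, f (c • v) := by
  have h := Measure.map_addHaar_smul (volume : Measure (EuclideanSpace ℝ (Fin m))) hc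
  have h2 : ∫⁻ v, f (c • v) = ∫⁻ v, f v ∂(Measure.map (c • ·) volume) :=
    ((Homeomorph.smulOfNeZero c hc).measurableEmbedding.lintegral_map f).symm
  rw [h2, h, lintegral_smul_measure, smul_eq_mul, ← mul_assoc, ← ENNReal.ofReal_mul (by positivity)]
  simp [abs_inv, hc]

lemma lintegral_comp_mul_real (f : ℝ → ℝ≥0∞) {c : ℝ} (hc : c ≠ 0) :
    ∫⁻ v, f v = ENNReal.ofReal |c| * ∫⁻ v, f (c * v) := by
  have h := Measure.map_addHaar_smul (volume : Measure ℝ) hc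
  have h2 : ∫⁻ v, f (c * v) = ∫⁻ v, f v ∂(Measure.map (c • ·) volume) :=
    ((Homeomorph.smulOfNeZero c hc).measurableEmbedding.lintegral_map f).symm
  rw [h2, h, lintegral_smul_measure, smul_eq_mul, ← mul_assoc, ← ENNReal.ofReal_mul (by positivity)]
  simp [abs_inv, hc]

lemma lintegral_comp_abs (f : ℝ → ℝ≥0∞) :
    ∫⁻ s, f |s| = 2 * ∫⁻ s in Ioi (0 : ℝ), f s := by
  have hneg : ∫⁻ s in Iio (0 : ℝ), f |s| = ∫⁻ s in Ioi (0 : ℝ), f s := by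
    have := (Measure.measurePreserving_neg (volume : Measure ℝ)).setLIntegral_comp_preimage_emb
      (MeasurableEquiv.neg ℝ).measurableEmbedding (fun s => f |s|) (Ioi 0)
    simp only [abs_neg] at this
    have h2 : (Neg.neg ⁻¹' Ioi (0 : ℝ)) = Iio 0 := by ext; simp
    rw [h2] at this
    rw [this]
    exact setLIntegral_congr_fun measurableSet_Ioi fun s hs => by rw [abs_of_pos hs]
  rw [← lintegral_add_compl (fun s => f |s|) (measurableSet_Ioi (a := (0 : ℝ))), compl_Ioi,
    restrict_Iio_eq_restrict_Iic.symm, hneg, two_mul]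
  congr 1
  exact setLIntegral_congr_fun measurableSet_Ioi fun s hs => by rw [abs_of_pos hs]

lemma lintegral_pow_mul_exp_neg (d : ℕ) :
    ∫⁻ r in Ioi (0 : ℝ), ENNReal.ofReal (r ^ d) * ENNReal.ofReal (Real.exp (-r)) =
      ENNReal.ofReal (Real.Gamma (d + 1)) := by
  rw [Real.Gamma_eq_integral (by positivity), ofReal_integral_eq_lintegral_ofReal]
  · refine setLIntegral_congr_fun measurableSet_Ioi fun r hr => ?_
    rw [← ENNReal.ofReal_mul (pow_nonneg (le_of_lt hr) _), mul_comm]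
    simp
  · exact Real.GammaIntegral_convergent (by positivity)
  · filter_upwards [ae_restrict_mem measurableSet_Ioi] with r hr
    have : (0 : ℝ) < r := hr
    positivity

/-- Rotation invariance of surface measure, inherited from that of Lebesgue measure. -/
lemma lintegral_sphere_comp_linearIsometryEquiv {G : EuclideanSpace ℝ (Fin (d + 1)) → ℝ≥0∞}
    (hG : Measurable G) (hom : ∀ c : ℝ, c ≠ 0 → ∀ x, G (c • x) = G x)
    (R : EuclideanSpace ℝ (Fin (d + 1)) ≃ₗᵢ[ℝ] EuclideanSpace ℝ (Fin (d + 1))) :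
    ∫⁻ σ : Metric.sphere (0 : EuclideanSpace ℝ (Fin (d + 1))) 1, G (R σ)
      ∂(surfaceMeasure (d + 1)) = ∫⁻ σ, G σ ∂(surfaceMeasure (d + 1)) := by
  have hw : Measurable (fun r : ℝ => ENNReal.ofReal (Real.exp (-r))) := by fun_prop
  have h1 := lintegral_eq_sphere_mul_radial hG hom hw
  have h2 := lintegral_eq_sphere_mul_radial (G := fun x => G (R x))
    (hG.comp R.continuous.measurable) (fun c hc x => by rw [map_smul, hom c hc]) hw
  have h3 := R.measurePreserving.lintegral_comp
    (by fun_prop : Measurable fun x => G x * ENNReal.ofReal (Real.exp (-‖x‖)))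
  simp only [LinearIsometryEquiv.norm_map] at h3
  rw [h1, h2, lintegral_pow_mul_exp_neg] at h3
  refine (ENNReal.mul_left_inj ?_ (by simp)).1 h3
  simpa using Real.Gamma_pos_of_pos (by positivity)

/-- Central projection of the sphere onto the hyperplane at height `h`. -/
lemma lintegral_sphere_eq_hyperplane {G : EuclideanSpace ℝ (Fin (d + 1)) → ℝ≥0∞}
    (hG : Measurable G) (hom : ∀ c : ℝ, c ≠ 0 → ∀ x, G (c • x) = G x) {h : ℝ} (hh : 0 < h) :
    ∫⁻ σ, G σ ∂(surfaceMeasure (d + 1)) =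
      2 * ∫⁻ v : EuclideanSpace ℝ (Fin d),
        G (snocPoint v h) * ENNReal.ofReal (h / ‖snocPoint v h‖ ^ (d + 1)) := by
  set w : ℝ → ℝ≥0∞ := fun r => ENNReal.ofReal (Real.exp (-r)) with hwdef
  have hw : Measurable w := by fun_prop
  set W : ℝ≥0∞ := ∫⁻ r in Ioi (0 : ℝ), ENNReal.ofReal (r ^ d) * w r with hW
  have hWval : W = ENNReal.ofReal (Real.Gamma (d + 1)) := lintegral_pow_mul_exp_neg d
  have hW0 : W ≠ 0 := by
    rw [hWval]; simpa using Real.Gamma_pos_of_pos (by positivity)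
  have hWtop : W ≠ ∞ := by rw [hWval]; simp
  have hgm : Measurable (fun v : EuclideanSpace ℝ (Fin d) => G (snocPoint v h)) :=
    hG.comp (continuous_snocPoint.comp (by fun_prop : Continuous fun v => (v, h))).measurable
  have hrm : Measurable (fun v : EuclideanSpace ℝ (Fin d) => ‖snocPoint v h‖) :=
    (continuous_snocPoint.comp (by fun_prop : Continuous fun v => (v, h))).norm.measurable
  have key : ∫⁻ x, G x * w ‖x‖ = (2 * ∫⁻ v : EuclideanSpace ℝ (Fin d),
        G (snocPoint v h) * ENNReal.ofReal (h / ‖snocPoint v h‖ ^ (d + 1))) * W := by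
    have hm : Measurable (fun x => G x * w ‖x‖) := by fun_prop
    rw [← measurePreserving_snocPoint.lintegral_comp hm,
      lintegral_prod_symm' (fun a : EuclideanSpace ℝ (Fin d) × ℝ =>
        G (snocPoint a.1 a.2) * w ‖snocPoint a.1 a.2‖) (hm.comp continuous_snocPoint.measurable)]
    -- Each slice at height `s ≠ 0` is rescaled to height `h`. Negative `s` is included because `G`
    -- is invariant under negative factors too; this is the source of the factor 2.
    have step : ∀ᵐ s : ℝ, ∫⁻ v : EuclideanSpace ℝ (Fin d),
        G (snocPoint v s) * w ‖snocPoint v s‖ =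
        ∫⁻ v : EuclideanSpace ℝ (Fin d), G (snocPoint v h) *
          (ENNReal.ofReal (|s / h| ^ d) * w (|s / h| * ‖snocPoint v h‖)) := by
      filter_upwards [Measure.ae_ne volume 0] with s hs
      have hc : s / h ≠ 0 := div_ne_zero hs hh.ne'
      rw [lintegral_comp_smul_euclidean _ hc, ← lintegral_const_mul' _ _ (by simp)]
      refine lintegral_congr fun v => ?_
      have : snocPoint ((s / h) • v) s = (s / h) • snocPoint v h := by
        rw [smul_snocPoint, div_mul_cancel₀ _ hh.ne']
      rw [this, hom _ hc, norm_smul, Real.norm_eq_abs]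
      ring
    rw [lintegral_congr_ae step, lintegral_lintegral_swap]
    · rw [mul_assoc, mul_comm _ W, ← mul_assoc, ← lintegral_const_mul' _ _ (by finiteness)]
      refine lintegral_congr fun v => ?_
      have hr : 0 < ‖snocPoint v h‖ := by rw [norm_snocPoint]; positivity
      set r := ‖snocPoint v h‖
      rw [lintegral_const_mul _ (by fun_prop), mul_left_comm]
      congr 1
      -- With `s = (h/r) u` the weight no longer depends on `v`, and the `s`-integral becomes a
      -- power of `r` times the radial integral `W`.
      rw [lintegral_comp_mul_real _ (c := h / r) (by positivity)]
      have : ∀ u : ℝ, ENNReal.ofReal (|h / r * u / h| ^ d) * w (|h / r * u / h| * r) =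
          ENNReal.ofReal (1 / r ^ d) * (ENNReal.ofReal (|u| ^ d) * w |u|) := by
        intro u
        have e : |h / r * u / h| = |u| / r := by
          rw [show h / r * u / h = u / r by field_simp, abs_div, abs_of_pos hr]
        rw [e, div_mul_cancel₀ _ hr.ne', ← mul_assoc,
          ← ENNReal.ofReal_mul (p := 1 / r ^ d) (by positivity), div_pow, one_div_mul_eq_div]
      simp_rw [this]
      rw [lintegral_const_mul' _ _ (by simp),
        lintegral_comp_abs (fun u => ENNReal.ofReal (u ^ d) * w u), ← hW, ← mul_assoc,
        ← ENNReal.ofReal_mul (by positivity), abs_of_pos (by positivity : 0 < h / r)]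
      rw [show h / r * (1 / r ^ d) = h / r ^ (d + 1) by rw [pow_succ]; field_simp]
      ring
    · apply Measurable.aemeasurable
      apply Measurable.mul
      · exact hgm.comp measurable_snd
      · have : Measurable (fun z : ℝ × EuclideanSpace ℝ (Fin d) => ‖snocPoint z.2 h‖) :=
          hrm.comp measurable_snd
        fun_prop
  rw [lintegral_eq_sphere_mul_radial hG hom hw] at key
  exact (ENNReal.mul_left_inj hW0 hWtop).1 key

end Polar

/-! ### Hölder duality for scalar and vector kernels. -/

section Duality

variable {Ω : Type*} [MeasurableSpace Ω] {μ : Measure Ω}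

lemma abs_integral_mul_le_eLpNorm {p q : ℝ≥0∞} [p.HolderConjugate q] {g k : Ω → ℝ}
    (hg : MemLp g p μ) (hk : MemLp k q μ) :
    |∫ w, g w * k w ∂μ| ≤ (eLpNorm k q μ).toReal * (eLpNorm g p μ).toReal := by
  have h1 : |∫ w, g w * k w ∂μ| ≤ ∫ w, ‖(g • k) w‖ ∂μ :=
    norm_integral_le_integral_norm (g • k)
  rw [integral_norm_eq_lintegral_enorm (hg.1.smul hk.1), ← eLpNorm_one_eq_lintegral_enorm] at h1
  refine h1.trans ?_
  rw [mul_comm, ← ENNReal.toReal_mul]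
  exact ENNReal.toReal_mono (ENNReal.mul_ne_top hg.2.ne hk.2.ne)
    (eLpNorm_smul_le_mul_eLpNorm hk.1 hg.1)

lemma toReal_eLpNorm_ofReal {k : Ω → ℝ} {q : ℝ} (hq : 0 < q) (hk : MemLp k (ENNReal.ofReal q) μ) :
    (eLpNorm k (ENNReal.ofReal q) μ).toReal = (∫ w, |k w| ^ q ∂μ) ^ (1 / q) := by
  rw [hk.eLpNorm_eq_integral_rpow_norm (by simpa using hq) (by simp), ENNReal.toReal_ofReal hq.le,
    ENNReal.toReal_ofReal (by positivity), one_div]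
  simp only [Real.norm_eq_abs]

/-- An extremal function in Hölder's inequality for a fixed factor `k` in `L^q`, `q < ∞`. -/
lemma exists_extremal_of_memLp {p : ℝ≥0∞} {q : ℝ} (hq : 1 ≤ q)
    [hpq : p.HolderConjugate (ENNReal.ofReal q)] {k : Ω → ℝ}
    (hk : MemLp k (ENNReal.ofReal q) μ) (hpos : 0 < (eLpNorm k (ENNReal.ofReal q) μ).toReal) :
    ∃ g : Ω → ℝ, MemLp g p μ ∧ 0 < (eLpNorm g p μ).toReal ∧
      (eLpNorm k (ENNReal.ofReal q) μ).toReal * (eLpNorm g p μ).toReal ≤ ∫ w, g w * k w ∂μ := by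
  have hq0 : 0 < q := by linarith
  set N := (eLpNorm k (ENNReal.ofReal q) μ).toReal with hN
  set A := ∫ w, |k w| ^ q ∂μ with hA
  have hA0 : 0 ≤ A := integral_nonneg fun w => by positivity
  have hNA : N = A ^ (1 / q) := toReal_eLpNorm_ofReal hq0 hk
  have hApos : 0 < A := by
    rcases hA0.eq_or_lt with h | h
    · rw [hNA, ← h, Real.zero_rpow (by positivity)] at hpos
      exact absurd hpos (lt_irrefl _)
    · exact h
  set g : Ω → ℝ := fun w => SignType.sign (k w) * |k w| ^ (q - 1) with hg
  have hgk : ∀ w, g w * k w = |k w| ^ q := by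
    intro w
    rcases eq_or_ne (k w) 0 with h | h
    · simp [h, Real.zero_rpow hq0.ne']
    · simp only [hg]
      rw [mul_right_comm, sign_mul_self, Real.rpow_sub_one (by simpa using h)]
      field_simp
  -- Only an inequality: for `q = 1`, at a zero of `k`, the left side is 0 while `0 ^ 0 = 1`.
  have habs : ∀ w, |g w| ≤ |k w| ^ (q - 1) := by
    intro w
    simp only [hg, abs_mul]
    rw [abs_of_nonneg (by positivity : 0 ≤ |k w| ^ (q - 1))]
    refine mul_le_of_le_one_left (by positivity) ?_
    rcases lt_trichotomy (k w) 0 with h | h | h <;> simp [h]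
  have hgm : AEStronglyMeasurable g μ := by
    have h1 := hk.1.aemeasurable
    refine AEMeasurable.aestronglyMeasurable ?_
    refine AEMeasurable.mul ?_ (by fun_prop)
    have : Measurable (fun y : ℝ => ((SignType.sign y : SignType) : ℝ)) := by
      have : (fun y : ℝ => ((SignType.sign y : SignType) : ℝ)) =
          fun y => if 0 < y then 1 else if y < 0 then -1 else 0 := by
        funext y
        rcases lt_trichotomy y 0 with h | h | h
        · simp [h, h.le]
        · simp [h]
        · simp [h]
      rw [this]
      exact Measurable.ite measurableSet_Ioi measurable_const
        (Measurable.ite measurableSet_Iio measurable_const measurable_const)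
    exact this.comp_aemeasurable h1
  have hint : ∫ w, g w * k w ∂μ = A := integral_congr_ae (.of_forall hgk)
  have main : MemLp g p μ ∧ N * (eLpNorm g p μ).toReal ≤ A := by
    rcases hq.eq_or_lt with h1 | h1
    · subst h1
      have hptop : p = ∞ := by
        have h2 := hpq
        rw [ENNReal.ofReal_one] at h2
        exact (ENNReal.HolderConjugate.unique 1 p ∞ : p = ∞)
      subst hptop
      have hb : ∀ᵐ w ∂μ, ‖g w‖ ≤ 1 := .of_forall fun w => by simpa using habs w
      refine ⟨memLp_top_of_bound hgm 1 hb, ?_⟩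
      have : (eLpNorm g ∞ μ).toReal ≤ 1 := by
        refine ENNReal.toReal_le_of_le_ofReal zero_le_one ?_
        rw [eLpNorm_exponent_top]
        exact eLpNormEssSup_le_of_ae_bound hb
      calc N * (eLpNorm g ∞ μ).toReal ≤ N * 1 := by gcongr
        _ = A := by rw [hNA]; simp
    · have hconj : (ENNReal.ofReal q).toReal.HolderConjugate p.toReal := by
        have := hpq.symm
        exact ENNReal.HolderConjugate.toReal (by rwa [ENNReal.toReal_ofReal hq0.le])
      rw [ENNReal.toReal_ofReal hq0.le] at hconj
      set P := p.toReal with hP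
      have hp0 : 0 < P := hconj.symm.pos
      have hptop : p ≠ ∞ := by rintro rfl; simp [hP] at hp0
      have hpp : p = ENNReal.ofReal P := (ENNReal.ofReal_toReal hptop).symm
      have hpow : ∀ w, |g w| ^ P = |k w| ^ q := by
        intro w
        have h2 : (q - 1) * P = q := hconj.sub_one_mul_conj
        rcases eq_or_ne (k w) 0 with h | h
        · simp [hg, h, Real.zero_rpow hq0.ne', Real.zero_rpow hp0.ne']
        · have : |g w| = |k w| ^ (q - 1) := by
            simp only [hg, abs_mul]
            rw [abs_of_nonneg (by positivity : 0 ≤ |k w| ^ (q - 1))]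
            rcases lt_or_gt_of_ne h with h | h <;> simp [h]
          rw [this, ← Real.rpow_mul (abs_nonneg _), h2]
      have hgp : MemLp g p μ := by
        rw [hpp, ← integrable_norm_rpow_iff hgm (by simpa using hp0) (by simp),
          ENNReal.toReal_ofReal hp0.le]
        simp only [Real.norm_eq_abs, hpow]
        have := hk.integrable_norm_rpow (by simpa using hq0) (by simp)
        simpa only [ENNReal.toReal_ofReal hq0.le, Real.norm_eq_abs] using this
      refine ⟨hgp, ?_⟩
      have hgn : (eLpNorm g p μ).toReal = A ^ (1 / P) := by
        rw [hpp] at hgp ⊢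
        rw [toReal_eLpNorm_ofReal hp0 hgp]
        simp only [hpow, hA]
      rw [hgn, hNA, ← Real.rpow_add hApos, one_div, one_div, hconj.inv_add_inv_eq_one,
        Real.rpow_one]
  refine ⟨g, main.1, ?_, hint ▸ main.2⟩
  have := abs_integral_mul_le_eLpNorm main.1 hk
  rw [hint, abs_of_pos hApos] at this
  exact pos_of_mul_pos_right (hApos.trans_le this) hpos.le

variable {E : Type*} [NormedAddCommGroup E] [InnerProductSpace ℝ E] [CompleteSpace E]

/-- Pairing the vector integral with its own direction reduces the bound to scalar Hölder. -/
lemma norm_integral_smul_le_of_forall_unit {p q : ℝ≥0∞} [p.HolderConjugate q] {g : Ω → ℝ}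
    {K : Ω → E} (hg : MemLp g p μ) (hK : MemLp K q μ) {M : ℝ} (hM0 : 0 ≤ M)
    (hM : ∀ z : E, ‖z‖ = 1 → (eLpNorm (fun w => inner ℝ z (K w)) q μ).toReal ≤ M) :
    ‖∫ w, g w • K w ∂μ‖ ≤ M * (eLpNorm g p μ).toReal := by
  set V := ∫ w, g w • K w ∂μ with hV
  rcases eq_or_ne V 0 with h0 | h0
  · rw [h0, norm_zero]; positivity
  have hint : Integrable (fun w => g w • K w) μ := memLp_one_iff_integrable.1 (hK.smul hg)
  have hn : ‖V‖ ≠ 0 := norm_ne_zero_iff.2 h0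
  set z := ‖V‖⁻¹ • V with hz
  have hz1 : ‖z‖ = 1 := by rw [hz, norm_smul, norm_inv, norm_norm, inv_mul_cancel₀ hn]
  have h1 : ‖V‖ = ∫ w, g w * inner ℝ z (K w) ∂μ := by
    have h2 : inner ℝ z V = ‖V‖ := by
      rw [hz, real_inner_smul_left, real_inner_self_eq_norm_sq]
      field_simp
    rw [← h2, hV, ← integral_inner hint]
    simp only [real_inner_smul_right]
  have hKz : MemLp (fun w => inner ℝ z (K w)) q μ := hK.const_inner z
  calc ‖V‖ = |∫ w, g w * inner ℝ z (K w) ∂μ| := by rw [← h1, abs_of_nonneg (norm_nonneg _)]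
    _ ≤ _ := abs_integral_mul_le_eLpNorm hg hKz
    _ ≤ _ := by gcongr; exact hM z hz1

/-- The Hölder extremal of the scalar kernel `(z,K)` is a test function, and the component along `z`
is at most the norm. -/
lemma le_of_forall_norm_integral_smul_le {p : ℝ≥0∞} {q : ℝ} (hq : 1 ≤ q)
    [hpq : p.HolderConjugate (ENNReal.ofReal q)] {K : Ω → E}
    (hK : MemLp K (ENNReal.ofReal q) μ) {z : E} (hz : ‖z‖ = 1)
    (hpos : 0 < (eLpNorm (fun w => inner ℝ z (K w)) (ENNReal.ofReal q) μ).toReal) {C : ℝ}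
    (hC : ∀ g : Ω → ℝ, MemLp g p μ → ‖∫ w, g w • K w ∂μ‖ ≤ C * (eLpNorm g p μ).toReal) :
    (eLpNorm (fun w => inner ℝ z (K w)) (ENNReal.ofReal q) μ).toReal ≤ C := by
  obtain ⟨g, hg, hg0, hgN⟩ := exists_extremal_of_memLp (p := p) hq (hK.const_inner z) hpos
  have hint : Integrable (fun w => g w • K w) μ := memLp_one_iff_integrable.1 (hK.smul hg)
  have h1 : ∫ w, g w * inner ℝ z (K w) ∂μ = inner ℝ z (∫ w, g w • K w ∂μ) := by
    rw [← integral_inner hint]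
    simp only [real_inner_smul_right]
  rw [h1] at hgN
  have h2 := real_inner_le_norm z (∫ w, g w • K w ∂μ)
  rw [hz, one_mul] at h2
  exact le_of_mul_le_mul_right ((hgN.trans h2).trans (hC g hg)) hg0

/-- Interpolation between `L^1` and `L^∞`: `|f|^q ≤ B^(q-1) |f|`. -/
lemma memLp_of_integrable_of_bound {f : Ω → ℝ} (hf : Integrable f μ) {B : ℝ}
    (hB : ∀ᵐ w ∂μ, ‖f w‖ ≤ B) {q : ℝ≥0∞} (hq : 1 ≤ q) : MemLp f q μ := by
  rcases eq_or_ne q ∞ with rfl | hqt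
  · exact memLp_top_of_bound hf.1 B hB
  have hq1 : 1 ≤ q.toReal := by
    rw [← ENNReal.toReal_one]; exact ENNReal.toReal_mono hqt hq
  rw [← integrable_norm_rpow_iff hf.1 (by positivity) hqt]
  refine (hf.norm.const_mul (B ^ (q.toReal - 1))).mono' ?_ ?_
  · exact (hf.1.norm.aemeasurable.pow_const _).aestronglyMeasurable
  · filter_upwards [hB] with w hw
    rw [Real.norm_of_nonneg (by positivity)]
    rcases (norm_nonneg (f w)).eq_or_lt with h0 | h0
    · rw [← h0, Real.zero_rpow (by linarith)]; simp
    · calc ‖f w‖ ^ q.toReal = ‖f w‖ ^ (q.toReal - 1) * ‖f w‖ := by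
            rw [Real.rpow_sub_one h0.ne']; field_simp
        _ ≤ _ := by gcongr

end Duality

/-! ### The gradient kernel and differentiation under the integral. -/

/-- The spatial gradient of the kernel of the heat single-layer potential, at `w = (y', τ)`. -/
noncomputable def singleLayerGradKernel {d : ℕ} (a : ℝ) (x : EuclideanSpace ℝ (Fin (d + 1))) (t : ℝ)
    (w : EuclideanSpace ℝ (Fin d) × ℝ) : EuclideanSpace ℝ (Fin (d + 1)) :=
  (2 * a ^ 2 / (4 * a ^ 2 * Real.pi) ^ (((d + 1 : ℕ) : ℝ) / 2) *
    (Real.exp (-‖x - boundaryPoint w.1‖ ^ 2 / (4 * a ^ 2 * (t - w.2))) /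
      (t - w.2) ^ (((d + 1 : ℕ) : ℝ) / 2)) / (2 * a ^ 2 * (t - w.2))) • (x - boundaryPoint w.1)

/-- Lebesgue measure on `ℝ^d × (0, t)`. -/
noncomputable def layerMeasure (d : ℕ) (t : ℝ) : Measure (EuclideanSpace ℝ (Fin d) × ℝ) :=
  volume.restrict ((univ : Set (EuclideanSpace ℝ (Fin d))) ×ˢ Ioo (0 : ℝ) t)

section Differentiation

variable {d : ℕ}

lemma measurable_boundaryPoint :
    Measurable (boundaryPoint : EuclideanSpace ℝ (Fin d) → EuclideanSpace ℝ (Fin (d + 1))) :=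
  (continuous_snocPoint.comp (by fun_prop : Continuous fun v => (v, (0 : ℝ)))).measurable

lemma norm_boundaryPoint (y : EuclideanSpace ℝ (Fin d)) : ‖boundaryPoint y‖ = ‖y‖ := by
  have := norm_snocPoint y 0
  rw [zero_pow two_ne_zero, add_zero, Real.sqrt_sq (norm_nonneg y)] at this
  exact this

lemma layerMeasure_eq_prod (t : ℝ) :
    layerMeasure d t = volume.prod (volume.restrict (Ioo 0 t)) := by
  rw [layerMeasure, Measure.volume_eq_prod, ← Measure.prod_restrict, Measure.restrict_univ]

lemma ae_layerMeasure (t : ℝ) : ∀ᵐ w ∂(layerMeasure d t), w.2 ∈ Ioo 0 t := by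
  filter_upwards [ae_restrict_mem (MeasurableSet.univ.prod measurableSet_Ioo)] with w hw
  exact hw.2

lemma measurable_singleLayerGradKernel (a : ℝ) (x : EuclideanSpace ℝ (Fin (d + 1))) (t : ℝ) :
    Measurable (singleLayerGradKernel a x t) := by
  have := measurable_boundaryPoint (d := d)
  unfold singleLayerGradKernel
  fun_prop

lemma le_norm_sub_boundaryPoint (x : EuclideanSpace ℝ (Fin (d + 1)))
    (y : EuclideanSpace ℝ (Fin d)) : x (Fin.last d) ≤ ‖x - boundaryPoint y‖ := by
  rw [sub_boundaryPoint, norm_snocPoint]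
  exact Real.le_sqrt_of_sq_le (le_add_of_nonneg_left (sq_nonneg _))

/-- Gaussian decay beats negative powers of time and gives polynomial decay in space. -/
lemma exists_gaussian_bound {b m h t : ℝ} (hb : 0 < b) (hh : 0 < h) (ht : 0 < t)
    (k : ℕ) :
    ∃ C : ℝ, 0 ≤ C ∧ ∀ s r : ℝ, 0 < s → s < t → h ≤ r →
      Real.exp (-(b * r ^ 2 / s)) / s ^ m ≤ C * (1 / r) ^ k := by
  -- The `N`-th term of the exponential series is used: `N ≥ m` leaves a nonnegative power of `s`,
  -- bounded through `t`, and `2N ≥ k` leaves a nonnegative power of `1/r`, bounded through `h`.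
  obtain ⟨N, hN⟩ := exists_nat_ge (max m k)
  have hNm : m ≤ N := (le_max_left _ _).trans hN
  have hNk : k ≤ N := by exact_mod_cast (le_max_right _ _).trans hN
  refine ⟨N.factorial * t ^ (N - m) / b ^ N * (1 / h) ^ (2 * N - k), by positivity, ?_⟩
  intro s r hs hst hr
  have hr0 : 0 < r := hh.trans_le hr
  have h1 := Real.pow_div_factorial_le_exp (b * r ^ 2 / s) (by positivity) N
  have h2 : Real.exp (-(b * r ^ 2 / s)) ≤ N.factorial * s ^ N / (b ^ N * r ^ (2 * N)) := by
    rw [Real.exp_neg, inv_le_comm₀ (Real.exp_pos _) (by positivity)]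
    refine le_trans (le_of_eq ?_) h1
    rw [pow_mul, div_pow, mul_pow]
    field_simp
  have h3 : s ^ N / s ^ m ≤ t ^ (N - m) := by
    rw [← Real.rpow_natCast, ← Real.rpow_sub hs]
    exact Real.rpow_le_rpow hs.le hst.le (by linarith)
  calc Real.exp (-(b * r ^ 2 / s)) / s ^ m
      ≤ N.factorial * s ^ N / (b ^ N * r ^ (2 * N)) / s ^ m := by gcongr
    _ = N.factorial * (s ^ N / s ^ m) / b ^ N * ((1 / r) ^ (2 * N - k) * (1 / r) ^ k) := by
        rw [← pow_add, Nat.sub_add_cancel (by omega), one_div, inv_pow]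
        field_simp
    _ ≤ N.factorial * t ^ (N - m) / b ^ N * ((1 / h) ^ (2 * N - k) * (1 / r) ^ k) := by
        gcongr
    _ = _ := by ring

/-- A dominating function for the gradient kernel, uniform near `x`. -/
lemma exists_bound_singleLayerGradKernel {a : ℝ} (ha : 0 < a)
    {x : EuclideanSpace ℝ (Fin (d + 1))} (hx : 0 < x (Fin.last d)) {t : ℝ} (ht : 0 < t) :
    ∃ C : ℝ, 0 ≤ C ∧ ∀ ξ ∈ Metric.ball x (x (Fin.last d) / 2),
      ∀ w : EuclideanSpace ℝ (Fin d) × ℝ, w.2 ∈ Ioo 0 t →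
        ‖singleLayerGradKernel a ξ t w‖ ≤ C * (1 + ‖w.1‖) ^ (-((d + 1 : ℕ) : ℝ)) := by
  set h := x (Fin.last d) with hh
  -- For `ξ` within `x_n/2` of `x`, `|ξ-y| ≥ r/2` turns `1/(4a²)` into `1/(16a²)`. The decay order
  -- `d + 2` loses one to the factor `|ξ-y|`, and `d + 1` is still integrable on `ℝ^d`.
  obtain ⟨C, hC0, hC⟩ := exists_gaussian_bound (b := 1 / (16 * a ^ 2)) (m := ((d + 1 : ℕ) : ℝ) / 2 + 1)
    (h := h) (t := t) (by positivity) hx ht (d + 2)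
  set c := 2 * a ^ 2 / (4 * a ^ 2 * Real.pi) ^ (((d + 1 : ℕ) : ℝ) / 2) with hc
  have hc0 : 0 < c := by positivity
  set B := (1 + ‖x‖) / h + 1 with hB
  refine ⟨c / (2 * a ^ 2) * C * (3 / 2) * B ^ (d + 1), by positivity, ?_⟩
  intro ξ hξ w hw
  have hs : 0 < t - w.2 := by linarith [hw.2]
  have hst : t - w.2 < t := by linarith [hw.1]
  set s := t - w.2 with hsd
  set r := ‖x - boundaryPoint w.1‖ with hr
  have hhr : h ≤ r := le_norm_sub_boundaryPoint x w.1
  have hr0 : 0 < r := hx.trans_le hhr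
  rw [Metric.mem_ball, dist_eq_norm] at hξ
  have hlow : r / 2 ≤ ‖ξ - boundaryPoint w.1‖ := by
    have h2 : x - boundaryPoint w.1 = (ξ - boundaryPoint w.1) - (ξ - x) := by abel
    have h3 : r ≤ ‖ξ - boundaryPoint w.1‖ + ‖ξ - x‖ := by rw [hr, h2]; exact norm_sub_le _ _
    linarith
  have hup : ‖ξ - boundaryPoint w.1‖ ≤ 3 / 2 * r := by
    have h2 : ξ - boundaryPoint w.1 = (x - boundaryPoint w.1) + (ξ - x) := by abel
    have h3 : ‖ξ - boundaryPoint w.1‖ ≤ r + ‖ξ - x‖ := by rw [h2]; exact norm_add_le _ _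
    linarith
  have hexp : Real.exp (-‖ξ - boundaryPoint w.1‖ ^ 2 / (4 * a ^ 2 * s)) ≤
      Real.exp (-(1 / (16 * a ^ 2) * r ^ 2 / s)) := by
    apply Real.exp_le_exp.2
    rw [neg_div, neg_le_neg_iff]
    calc 1 / (16 * a ^ 2) * r ^ 2 / s = (r / 2) ^ 2 / (4 * a ^ 2 * s) := by field_simp; norm_num
      _ ≤ _ := by gcongr
  have hBr : 1 + ‖w.1‖ ≤ B * r := by
    have h2 : ‖w.1‖ ≤ ‖x‖ + r := by
      calc ‖w.1‖ = ‖x - (x - boundaryPoint w.1)‖ := by rw [sub_sub_cancel, norm_boundaryPoint]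
        _ ≤ _ := norm_sub_le _ _
    calc 1 + ‖w.1‖ ≤ (1 + ‖x‖) / h * h + r := by rw [div_mul_cancel₀ _ hx.ne']; linarith
      _ ≤ (1 + ‖x‖) / h * r + r := by gcongr
      _ = B * r := by rw [hB]; ring
  have hfin : (1 / r) ^ (d + 1) ≤ B ^ (d + 1) * (1 + ‖w.1‖) ^ (-((d + 1 : ℕ) : ℝ)) := by
    rw [Real.rpow_neg (by positivity), Real.rpow_natCast, ← inv_pow, ← mul_pow]
    gcongr
    rw [← div_eq_mul_inv, div_le_div_iff₀ hr0 (by positivity)]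
    linarith
  rw [singleLayerGradKernel, norm_smul, Real.norm_eq_abs, abs_of_nonneg (by positivity)]
  calc c * (Real.exp (-‖ξ - boundaryPoint w.1‖ ^ 2 / (4 * a ^ 2 * s)) /
        s ^ (((d + 1 : ℕ) : ℝ) / 2)) / (2 * a ^ 2 * s) * ‖ξ - boundaryPoint w.1‖
      ≤ c * (Real.exp (-(1 / (16 * a ^ 2) * r ^ 2 / s)) /
        s ^ (((d + 1 : ℕ) : ℝ) / 2)) / (2 * a ^ 2 * s) * (3 / 2 * r) := by gcongr
    _ = c / (2 * a ^ 2) * (3 / 2) * r * (Real.exp (-(1 / (16 * a ^ 2) * r ^ 2 / s)) /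
        s ^ (((d + 1 : ℕ) : ℝ) / 2 + 1)) := by
        rw [Real.rpow_add_one hs.ne']; field_simp
    _ ≤ c / (2 * a ^ 2) * (3 / 2) * r * (C * (1 / r) ^ (d + 2)) := by
        gcongr
        exact hC s r hs hst hhr
    _ = c / (2 * a ^ 2) * C * (3 / 2) * (1 / r) ^ (d + 1) := by
        rw [pow_succ (1 / r) (d + 1)]; field_simp
    _ ≤ c / (2 * a ^ 2) * C * (3 / 2) * (B ^ (d + 1) * (1 + ‖w.1‖) ^ (-((d + 1 : ℕ) : ℝ))) := by
        gcongr
    _ = _ := by ring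

lemma memLp_one_add_norm_rpow (t : ℝ) {q : ℝ≥0∞} (hq : 1 ≤ q) :
    MemLp (fun w : EuclideanSpace ℝ (Fin d) × ℝ => (1 + ‖w.1‖) ^ (-((d + 1 : ℕ) : ℝ))) q
      (layerMeasure d t) := by
  have h1 : Integrable (fun y : EuclideanSpace ℝ (Fin d) => (1 + ‖y‖) ^ (-((d + 1 : ℕ) : ℝ))) :=
    integrable_one_add_norm (by simp)
  refine memLp_of_integrable_of_bound (B := 1) ?_ (.of_forall fun w => ?_) hq
  · rw [layerMeasure_eq_prod]
    exact h1.comp_fst _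
  · rw [Real.norm_of_nonneg (by positivity)]
    exact Real.rpow_le_one_of_one_le_of_nonpos (by linarith [norm_nonneg w.1])
      (neg_nonpos.2 (Nat.cast_nonneg _))

lemma memLp_singleLayerGradKernel {a : ℝ} (ha : 0 < a)
    {x : EuclideanSpace ℝ (Fin (d + 1))} (hx : 0 < x (Fin.last d)) {t : ℝ} (ht : 0 < t)
    {q : ℝ≥0∞} (hq : 1 ≤ q) : MemLp (singleLayerGradKernel a x t) q (layerMeasure d t) := by
  obtain ⟨C, hC0, hC⟩ := exists_bound_singleLayerGradKernel (d := d) ha hx ht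
  refine ((memLp_one_add_norm_rpow t hq).const_mul C).mono'
    (measurable_singleLayerGradKernel a x t).aestronglyMeasurable ?_
  filter_upwards [ae_layerMeasure t] with w hw
  exact hC x (Metric.mem_ball_self (by positivity)) w hw

lemma aestronglyMeasurable_singleLayerIntegrand {a t : ℝ} {g : EuclideanSpace ℝ (Fin d) × ℝ → ℝ}
    {μ : Measure (EuclideanSpace ℝ (Fin d) × ℝ)} (hg : AEStronglyMeasurable g μ)
    (x : EuclideanSpace ℝ (Fin (d + 1))) :
    AEStronglyMeasurable (singleLayerIntegrand a g x t) μ := by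
  have := measurable_boundaryPoint (d := d)
  unfold singleLayerIntegrand
  exact (Measurable.aestronglyMeasurable (by fun_prop)).mul hg

/-- Since `|x-y| ≥ x_n` and `t-τ < t`, the potential's integrand is at most a constant times the
norm of `g K`, which is integrable by Hölder. -/
lemma integrable_singleLayerIntegrand {a : ℝ} (ha : 0 < a)
    {x : EuclideanSpace ℝ (Fin (d + 1))} (hx : 0 < x (Fin.last d)) {t : ℝ} (ht : 0 < t)
    {p q : ℝ≥0∞} [p.HolderConjugate q] {g : EuclideanSpace ℝ (Fin d) × ℝ → ℝ}
    (hg : MemLp g p (layerMeasure d t)) :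
    Integrable (singleLayerIntegrand a g x t) (layerMeasure d t) := by
  have hq : 1 ≤ q := ENNReal.HolderConjugate.one_le q p
  set c := 2 * a ^ 2 / (4 * a ^ 2 * Real.pi) ^ (((d + 1 : ℕ) : ℝ) / 2) with hc
  have hc0 : 0 < c := by positivity
  have h1 : Integrable (fun w => g w • singleLayerGradKernel a x t w) (layerMeasure d t) :=
    memLp_one_iff_integrable.1 ((memLp_singleLayerGradKernel ha hx ht hq).smul hg)
  refine (h1.norm.const_mul (2 * a ^ 2 * t / (c * x (Fin.last d)))).mono'
    (aestronglyMeasurable_singleLayerIntegrand hg.1 x) ?_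
  filter_upwards [ae_layerMeasure t] with w hw
  have hs : 0 < t - w.2 := by linarith [hw.2]
  have hst : t - w.2 < t := by linarith [hw.1]
  have hr := le_norm_sub_boundaryPoint x w.1
  rw [singleLayerIntegrand, singleLayerGradKernel, norm_smul, norm_smul, norm_mul, ← hc]
  set s := t - w.2
  set e := Real.exp (-‖x - boundaryPoint w.1‖ ^ 2 / (4 * a ^ 2 * s)) /
    s ^ (((d + 1 : ℕ) : ℝ) / 2) with he
  have he0 : 0 < e := by positivity
  rw [Real.norm_of_nonneg he0.le, Real.norm_of_nonneg (by positivity : 0 ≤ c * e / (2 * a ^ 2 * s))]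
  calc e * ‖g w‖ = 2 * a ^ 2 * s / (c * x (Fin.last d)) *
        (‖g w‖ * (c * e / (2 * a ^ 2 * s) * x (Fin.last d))) := by field_simp
    _ ≤ _ := by gcongr

/-- The gradient of the potential is obtained by differentiating under the integral sign. -/
lemma hasGradientAt_singleLayer {a : ℝ} (ha : 0 < a)
    {x : EuclideanSpace ℝ (Fin (d + 1))} (hx : 0 < x (Fin.last d)) {t : ℝ} (ht : 0 < t)
    {p q : ℝ≥0∞} [p.HolderConjugate q] {g : EuclideanSpace ℝ (Fin d) × ℝ → ℝ}
    (hg : MemLp g p (layerMeasure d t)) :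
    HasGradientAt (fun ξ => singleLayer a g ξ t)
      (∫ w, g w • singleLayerGradKernel a x t w ∂(layerMeasure d t)) x := by
  have hq : 1 ≤ q := ENNReal.HolderConjugate.one_le q p
  set c := 2 * a ^ 2 / (4 * a ^ 2 * Real.pi) ^ (((d + 1 : ℕ) : ℝ) / 2) with hc
  have hc0 : 0 < c := by positivity
  obtain ⟨C, hC0, hC⟩ := exists_bound_singleLayerGradKernel (d := d) ha hx ht
  have hbound : Integrable (fun w => ‖g w‖ * (C * (1 + ‖w.1‖) ^ (-((d + 1 : ℕ) : ℝ))))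
      (layerMeasure d t) := by
    have h2 : Integrable (fun w => g w * (C * (1 + ‖w.1‖) ^ (-((d + 1 : ℕ) : ℝ))))
      (layerMeasure d t) := hg.integrable_mul ((memLp_one_add_norm_rpow t hq).const_mul C)
    refine h2.norm.congr (.of_forall fun w => ?_)
    simp only [norm_mul]
    rw [Real.norm_of_nonneg hC0, Real.norm_of_nonneg
      (by positivity : 0 ≤ (1 + ‖w.1‖) ^ (-((d + 1 : ℕ) : ℝ)))]
  have hint : Integrable (fun w => g w • singleLayerGradKernel a x t w) (layerMeasure d t) :=
    memLp_one_iff_integrable.1 ((memLp_singleLayerGradKernel ha hx ht hq).smul hg)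
  rw [hasGradientAt_iff_hasFDerivAt]
  have main := hasFDerivAt_integral_of_dominated_of_fderiv_le (𝕜 := ℝ) (μ := layerMeasure d t)
    -- The minus sign of the potential cancels the one from differentiating the Gaussian, so the
    -- kernel has a positive coefficient.
    (F := fun ξ w => -c * singleLayerIntegrand a g ξ t w)
    (F' := fun ξ w => innerSL ℝ (g w • singleLayerGradKernel a ξ t w)) (x₀ := x)
    (bound := fun w => ‖g w‖ * (C * (1 + ‖w.1‖) ^ (-((d + 1 : ℕ) : ℝ))))
    (Metric.ball_mem_nhds x (by positivity : 0 < x (Fin.last d) / 2))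
    (.of_forall fun ξ => (aestronglyMeasurable_singleLayerIntegrand hg.1 ξ).const_mul _)
    ((integrable_singleLayerIntegrand ha hx ht hg (q := q)).const_mul _)
    ((innerSL ℝ).continuous.comp_aestronglyMeasurable hint.1) ?_ hbound ?_
  · have h0 : (fun ξ => singleLayer a g ξ t) =
        fun ξ => ∫ w, -c * singleLayerIntegrand a g ξ t w ∂(layerMeasure d t) := by
      funext ξ
      rw [integral_const_mul, singleLayer, layerMeasure]
    rw [h0]
    refine main.congr_fderiv ?_
    rw [(innerSL ℝ (E := EuclideanSpace ℝ (Fin (d + 1)))).integral_comp_comm hint]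
    rfl
  · filter_upwards [ae_layerMeasure t] with w hw ξ hξ
    rw [innerSL_apply_norm, norm_smul]
    gcongr
    exact hC ξ hξ w hw
  · filter_upwards [ae_layerMeasure t] with w hw ξ hξ
    have hs : 0 < t - w.2 := by linarith [hw.2]
    have h1 : HasFDerivAt (fun ξ : EuclideanSpace ℝ (Fin (d + 1)) => ‖ξ - boundaryPoint w.1‖ ^ 2)
        (2 • (innerSL ℝ (ξ - boundaryPoint w.1)) ∘L ContinuousLinearMap.id ℝ _) ξ :=
      ((hasFDerivAt_id ξ).sub_const (boundaryPoint w.1)).norm_sq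
    have h2 := (((h1.neg.mul_const (4 * a ^ 2 * (t - w.2))⁻¹).exp.mul_const
      (((t - w.2) ^ (((d + 1 : ℕ) : ℝ) / 2))⁻¹ * g w)).const_mul (-c))
    have h0 : (fun η => -c * singleLayerIntegrand a g η t w) = fun η => -c *
        (Real.exp (-‖η - boundaryPoint w.1‖ ^ 2 * (4 * a ^ 2 * (t - w.2))⁻¹) *
          (((t - w.2) ^ (((d + 1 : ℕ) : ℝ) / 2))⁻¹ * g w)) := by
      funext η
      simp only [singleLayerIntegrand, div_eq_mul_inv]
      ring
    rw [h0]
    refine h2.congr_fderiv ?_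
    ext v
    rw [singleLayerGradKernel, ← hc]
    clear_value c
    simp [div_eq_mul_inv]
    field_simp
    ring

end Differentiation

/-! ### Bounds and monotonicity of the incomplete Gamma weight. -/

section GammaWeight

lemma measurable_gammaWeight (κ lam : ℝ) : Measurable (gammaWeight κ lam) := by
  have h : gammaWeight κ lam = fun u => ∫ ξ, ({z : ℝ × ℝ | κ / z.1 ^ 2 < z.2}.indicator
      (fun z => z.2 ^ lam * Real.exp (-z.2))) (u, ξ) := by
    funext u
    rw [gammaWeight, ← integral_indicator measurableSet_Ioi]
    rfl
  rw [h]
  refine StronglyMeasurable.measurable (StronglyMeasurable.integral_prod_right' ?_)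
  refine Measurable.stronglyMeasurable (Measurable.indicator (by fun_prop) ?_)
  exact measurableSet_lt (by fun_prop) (by fun_prop)

lemma gammaWeight_abs (κ lam u : ℝ) : gammaWeight κ lam |u| = gammaWeight κ lam u := by
  rw [gammaWeight, sq_abs, gammaWeight]

variable {κ lam : ℝ}

lemma integrableOn_rpow_mul_exp_neg (hlam : -1 < lam) :
    IntegrableOn (fun ξ => ξ ^ lam * Real.exp (-ξ)) (Ioi (0 : ℝ)) := by
  have := Real.GammaIntegral_convergent (s := lam + 1) (by linarith)
  simpa [mul_comm] using this

lemma gammaWeight_nonneg (hκ : 0 ≤ κ) (u : ℝ) : 0 ≤ gammaWeight κ lam u := by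
  refine setIntegral_nonneg measurableSet_Ioi fun ξ hξ => ?_
  have : 0 < ξ := lt_of_le_of_lt (by positivity) hξ
  positivity

lemma gammaWeight_le_Gamma (hκ : 0 ≤ κ) (hlam : -1 < lam) (u : ℝ) :
    gammaWeight κ lam u ≤ Real.Gamma (lam + 1) := by
  have h1 : Real.Gamma (lam + 1) = ∫ ξ in Ioi (0 : ℝ), ξ ^ lam * Real.exp (-ξ) := by
    rw [Real.Gamma_eq_integral (by linarith)]
    simp [mul_comm]
  rw [h1, gammaWeight]
  refine setIntegral_mono_set (integrableOn_rpow_mul_exp_neg hlam) ?_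
    (Ioi_subset_Ioi (by positivity)).eventuallyLE
  filter_upwards [ae_restrict_mem measurableSet_Ioi] with ξ hξ
  have : (0 : ℝ) < ξ := hξ
  simp only [Pi.zero_apply]
  positivity

/-- On the range of integration `1 ≤ u²ξ/κ`, so a power of `ξ` can be traded for `u²`. This decay at
the equator absorbs the singular factor `|u|^α` down to `α = -2`. -/
lemma gammaWeight_le_sq_mul (hκ : 0 < κ) (hlam : -1 < lam) {u : ℝ} (hu : u ≠ 0) :
    gammaWeight κ lam u ≤ u ^ 2 / κ * Real.Gamma (lam + 2) := by
  have h2 : gammaWeight κ (lam + 1) u ≤ Real.Gamma (lam + 2) := by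
    have := gammaWeight_le_Gamma (lam := lam + 1) hκ.le (by linarith) u
    rwa [add_assoc, one_add_one_eq_two] at this
  have hu2 : 0 < u ^ 2 := by positivity
  have hpos : 0 < κ / u ^ 2 := by positivity
  calc gammaWeight κ lam u ≤ u ^ 2 / κ * gammaWeight κ (lam + 1) u := by
        rw [gammaWeight, gammaWeight, ← integral_const_mul]
        refine setIntegral_mono_on
          ((integrableOn_rpow_mul_exp_neg hlam).mono_set (Ioi_subset_Ioi hpos.le))
          (((integrableOn_rpow_mul_exp_neg (by linarith)).mono_set
            (Ioi_subset_Ioi hpos.le)).const_mul _) measurableSet_Ioi fun ξ hξ => ?_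
        have hξ' : κ / u ^ 2 < ξ := hξ
        have hξ0 : 0 < ξ := hpos.trans hξ
        rw [Real.rpow_add_one hξ0.ne']
        have h3 : 1 ≤ u ^ 2 / κ * ξ := by
          rw [div_lt_iff₀ hu2] at hξ'
          rw [div_mul_eq_mul_div, le_div_iff₀ hκ]
          linarith
        calc ξ ^ lam * Real.exp (-ξ) = 1 * (ξ ^ lam * Real.exp (-ξ)) := by ring
          _ ≤ u ^ 2 / κ * ξ * (ξ ^ lam * Real.exp (-ξ)) := by gcongr
          _ = _ := by ring
    _ ≤ _ := by gcongr

/-- The weight of the sphere integral is bounded. -/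
lemma exists_bound_gammaWeight_mul_rpow (hκ : 0 < κ) (hlam : -1 < lam) {α : ℝ} (hα : -2 ≤ α) :
    ∃ C : ℝ, 0 ≤ C ∧ ∀ u : ℝ, |u| ≤ 1 → gammaWeight κ lam u * |u| ^ α ≤ C := by
  refine ⟨max (Real.Gamma (lam + 1)) (Real.Gamma (lam + 2) / κ),
    le_max_of_le_left (Real.Gamma_pos_of_pos (by linarith)).le, fun u hu => ?_⟩
  -- Division by zero makes `κ / 0 ^ 2 = 0`, so the weight at `u = 0` is the full Gamma integral
  -- instead of the limit 0, and it needs its own bound.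
  rcases eq_or_ne u 0 with rfl | h
  · refine le_max_of_le_left ?_
    have h1 := gammaWeight_le_Gamma hκ.le hlam 0
    have h0 := gammaWeight_nonneg (lam := lam) hκ.le 0
    refine le_trans (mul_le_of_le_one_right h0 ?_) h1
    rw [abs_zero]
    exact Real.zero_rpow_le_one α
  · refine le_max_of_le_right ?_
    have hu0 : 0 < |u| := abs_pos.2 h
    calc gammaWeight κ lam u * |u| ^ α ≤ u ^ 2 / κ * Real.Gamma (lam + 2) * |u| ^ α := by
          gcongr
          exact gammaWeight_le_sq_mul hκ hlam h
      _ = Real.Gamma (lam + 2) / κ * |u| ^ (2 + α) := by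
          rw [Real.rpow_add hu0, Real.rpow_two, sq_abs]; ring
      _ ≤ Real.Gamma (lam + 2) / κ * 1 := by
          have := (Real.Gamma_pos_of_pos (by linarith : 0 < lam + 2)).le
          gcongr
          exact Real.rpow_le_one hu0.le hu (by linarith)
      _ = _ := mul_one _

/-- A larger `|u|` enlarges the domain of integration. The point `u = 0` is excluded because there
the weight takes its maximal value by convention. -/
lemma gammaWeight_le_of_abs_le (hκ : 0 ≤ κ) (hlam : -1 < lam) {u v : ℝ} (hu : u ≠ 0)
    (huv : |u| ≤ |v|) : gammaWeight κ lam u ≤ gammaWeight κ lam v := by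
  have hu2 : 0 < u ^ 2 := by positivity
  have h2 : u ^ 2 ≤ v ^ 2 := sq_le_sq.2 huv
  have h0 : 0 ≤ κ / v ^ 2 := by positivity
  refine setIntegral_mono_set ((integrableOn_rpow_mul_exp_neg hlam).mono_set (Ioi_subset_Ioi h0))
    ?_ (Ioi_subset_Ioi (by gcongr)).eventuallyLE
  filter_upwards [ae_restrict_mem measurableSet_Ioi] with ξ hξ
  have : (0 : ℝ) < ξ := h0.trans_lt hξ
  simp only [Pi.zero_apply]
  positivity

end GammaWeight

/-! ### The time integral as an incomplete Gamma integral. -/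

section TimeIntegral

lemma image_sub_div_Ioi {b t : ℝ} (hb : 0 < b) (ht : 0 < t) :
    (fun ξ => t - b / ξ) '' Ioi (b / t) = Ioo 0 t := by
  have hbt : 0 < b / t := by positivity
  ext τ
  simp only [mem_image, mem_Ioi, mem_Ioo]
  constructor
  · rintro ⟨ξ, hξ, rfl⟩
    have hξ0 : 0 < ξ := hbt.trans hξ
    have h1 : b / ξ < t := by
      rw [div_lt_iff₀ ht] at hξ
      rw [div_lt_iff₀ hξ0]; linarith
    have h2 : 0 < b / ξ := by positivity
    constructor <;> linarith
  · rintro ⟨h1, h2⟩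
    have h3 : 0 < t - τ := by linarith
    refine ⟨b / (t - τ), ?_, by field_simp; ring⟩
    gcongr
    linarith

/-- Substitution `ξ = b/(t-τ)`, with `dτ = (b/ξ²) dξ`. -/
lemma setIntegral_time_eq {b t m : ℝ} (hb : 0 < b) (ht : 0 < t) :
    ∫ τ in Ioo 0 t, Real.exp (-(b / (t - τ))) / (t - τ) ^ m =
      b ^ (1 - m) * ∫ ξ in Ioi (b / t), ξ ^ (m - 2) * Real.exp (-ξ) := by
  have hbt : 0 < b / t := by positivity
  rw [← image_sub_div_Ioi hb ht,
    integral_image_eq_integral_abs_deriv_smul (f' := fun ξ => b / ξ ^ 2) measurableSet_Ioi,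
    ← integral_const_mul]
  · refine setIntegral_congr_fun measurableSet_Ioi fun ξ hξ => ?_
    have hξ0 : 0 < ξ := hbt.trans hξ
    simp only [sub_sub_cancel, smul_eq_mul]
    rw [abs_of_pos (by positivity), Real.div_rpow hb.le hξ0.le, Real.rpow_sub hb, Real.rpow_one,
      Real.rpow_sub hξ0, Real.rpow_two, div_div_eq_mul_div, div_div_cancel₀ hb.ne']
    field_simp
  · intro ξ hξ
    have hξ0 : 0 < ξ := hbt.trans hξ
    have h1 := ((hasDerivAt_inv hξ0.ne').const_mul b).const_sub t
    refine HasDerivAt.hasDerivWithinAt ?_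
    convert h1 using 1 <;> simp [div_eq_mul_inv]
  · intro ξ hξ η hη h
    have hξ0 : 0 < ξ := hbt.trans hξ
    have hη0 : 0 < η := hbt.trans hη
    have h1 : b / ξ = b / η := by simpa using h
    rw [div_eq_div_iff hξ0.ne' hη0.ne'] at h1
    exact (mul_left_cancel₀ hb.ne' h1).symm

end TimeIntegral

/-! ### The sphere integral: integrability and continuity in `z`. -/

section SphereIntegral

variable {d : ℕ}

/-- The extension, homogeneous of degree zero, of
`ω_{κ,λ}((σ, y)) |(σ, y)|^α |(σ, z)|^β` from the unit sphere. -/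
noncomputable def sphereWeight (κ lam α β : ℝ) (y z X : EuclideanSpace ℝ (Fin (d + 1))) : ℝ :=
  gammaWeight κ lam (inner ℝ X y / ‖X‖) * |inner ℝ X y / ‖X‖| ^ α * |inner ℝ X z / ‖X‖| ^ β

lemma measurable_sphereWeight (κ lam α β : ℝ) (y z : EuclideanSpace ℝ (Fin (d + 1))) :
    Measurable (sphereWeight κ lam α β y z) := by
  have := measurable_gammaWeight κ lam
  unfold sphereWeight
  fun_prop

lemma sphereWeight_smul (κ lam α β : ℝ) (y z : EuclideanSpace ℝ (Fin (d + 1))) (c : ℝ)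
    (hc : c ≠ 0) (X : EuclideanSpace ℝ (Fin (d + 1))) :
    sphereWeight κ lam α β y z (c • X) = sphereWeight κ lam α β y z X := by
  have h : ∀ y : EuclideanSpace ℝ (Fin (d + 1)),
      |inner ℝ (c • X) y / ‖c • X‖| = |inner ℝ X y / ‖X‖| := by
    intro y
    have : |c| ≠ 0 := abs_ne_zero.2 hc
    rw [real_inner_smul_left, norm_smul, abs_div, abs_mul, abs_div, Real.norm_eq_abs,
      abs_mul, abs_abs, mul_div_mul_left _ _ this]
  rw [sphereWeight, sphereWeight, ← gammaWeight_abs, h, h, gammaWeight_abs]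

lemma sphereWeight_nonneg {κ : ℝ} (hκ : 0 ≤ κ) (lam α β : ℝ)
    (y z X : EuclideanSpace ℝ (Fin (d + 1))) : 0 ≤ sphereWeight κ lam α β y z X := by
  have := gammaWeight_nonneg (lam := lam) hκ (inner ℝ X y / ‖X‖)
  unfold sphereWeight
  positivity

lemma sphereIntegrand_eq_sphereWeight (κ lam α β : ℝ) (z : EuclideanSpace ℝ (Fin (d + 1)))
    (σ : Metric.sphere (0 : EuclideanSpace ℝ (Fin (d + 1))) 1) :
    sphereIntegrand κ lam α β z σ = sphereWeight κ lam α β (lastUnitVector d) z σ := by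
  simp [sphereIntegrand, sphereWeight]

lemma integral_sphere_eq_hyperplane {G : EuclideanSpace ℝ (Fin (d + 1)) → ℝ}
    (hG : Measurable G) (hG0 : ∀ x, 0 ≤ G x) (hom : ∀ c : ℝ, c ≠ 0 → ∀ x, G (c • x) = G x)
    {h : ℝ} (hh : 0 < h) :
    ∫ σ, G σ ∂(surfaceMeasure (d + 1)) =
      2 * ∫ v : EuclideanSpace ℝ (Fin d),
        G (snocPoint v h) * (h / ‖snocPoint v h‖ ^ (d + 1)) := by
  have hs : Measurable (fun v : EuclideanSpace ℝ (Fin d) => snocPoint v h) :=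
    (continuous_snocPoint.comp (by fun_prop : Continuous fun v => (v, h))).measurable
  have key := lintegral_sphere_eq_hyperplane (G := fun x => ENNReal.ofReal (G x))
    (by fun_prop) (fun c hc x => by rw [hom c hc]) hh
  rw [integral_eq_lintegral_of_nonneg_ae (.of_forall fun σ => hG0 _)
    (hG.comp measurable_subtype_coe).aestronglyMeasurable, key,
    integral_eq_lintegral_of_nonneg_ae (.of_forall fun v => mul_nonneg (hG0 _) (by positivity))
    (by fun_prop), ENNReal.toReal_mul]
  simp only [ENNReal.ofReal_mul (hG0 _), ENNReal.toReal_ofNat]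

lemma abs_inner_coe_sphere_le (z : EuclideanSpace ℝ (Fin (d + 1)))
    (σ : Metric.sphere (0 : EuclideanSpace ℝ (Fin (d + 1))) 1) :
    |inner ℝ (σ : EuclideanSpace ℝ (Fin (d + 1))) z| ≤ ‖z‖ := by
  simpa using abs_real_inner_le_norm (σ : EuclideanSpace ℝ (Fin (d + 1))) z

instance (m : ℕ) : IsFiniteMeasure (surfaceMeasure m) := by
  unfold surfaceMeasure; infer_instance

variable {κ lam α β : ℝ}

lemma exists_bound_sphereWeight (hκ : 0 < κ) (hlam : -1 < lam) (hα : -2 ≤ α) (hβ : 0 ≤ β)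
    {y : EuclideanSpace ℝ (Fin (d + 1))} (hy : ‖y‖ = 1) :
    ∃ C : ℝ, 0 ≤ C ∧ ∀ (z : EuclideanSpace ℝ (Fin (d + 1)))
      (σ : Metric.sphere (0 : EuclideanSpace ℝ (Fin (d + 1))) 1),
      ‖sphereWeight κ lam α β y z σ‖ ≤ C * ‖z‖ ^ β := by
  obtain ⟨C, hC0, hC⟩ := exists_bound_gammaWeight_mul_rpow hκ hlam hα
  refine ⟨C, hC0, fun z σ => ?_⟩
  rw [Real.norm_of_nonneg (sphereWeight_nonneg hκ.le ..)]
  simp only [sphereWeight, norm_eq_of_mem_sphere, div_one]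
  have h1 := abs_inner_coe_sphere_le y σ
  rw [hy] at h1
  gcongr
  · exact hC _ h1
  · exact abs_inner_coe_sphere_le z σ

lemma integrable_sphereWeight (hκ : 0 < κ) (hlam : -1 < lam) (hα : -2 ≤ α) (hβ : 0 ≤ β)
    {y : EuclideanSpace ℝ (Fin (d + 1))} (hy : ‖y‖ = 1) (z : EuclideanSpace ℝ (Fin (d + 1))) :
    Integrable (fun σ : Metric.sphere (0 : EuclideanSpace ℝ (Fin (d + 1))) 1 =>
      sphereWeight κ lam α β y z σ) (surfaceMeasure (d + 1)) := by
  obtain ⟨C, hC0, hC⟩ := exists_bound_sphereWeight (d := d) hκ hlam hα hβ hy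
  exact Integrable.of_bound ((measurable_sphereWeight κ lam α β y z).comp
    measurable_subtype_coe).aestronglyMeasurable _ (.of_forall (hC z))

lemma integrable_sphereIntegrand (hκ : 0 < κ) (hlam : -1 < lam) (hα : -2 ≤ α) (hβ : 0 ≤ β)
    (z : EuclideanSpace ℝ (Fin (d + 1))) :
    Integrable (sphereIntegrand κ lam α β z) (surfaceMeasure (d + 1)) := by
  refine (integrable_sphereWeight hκ hlam hα hβ norm_lastUnitVector z).congr
    (.of_forall fun σ => ?_)
  exact (sphereIntegrand_eq_sphereWeight κ lam α β z σ).symm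

lemma sphereIntegral_nonneg (hκ : 0 ≤ κ) (z : EuclideanSpace ℝ (Fin (d + 1))) :
    0 ≤ sphereIntegral κ lam α β z := by
  refine integral_nonneg fun σ => ?_
  rw [sphereIntegrand_eq_sphereWeight]
  exact sphereWeight_nonneg hκ ..

/-- Dominated convergence: `z` enters only through the continuous factor `|(σ,z)|^β`, and the rest
is bounded uniformly in `σ`. -/
lemma continuousOn_sphereIntegral (hκ : 0 < κ) (hlam : -1 < lam) (hα : -2 ≤ α) (hβ : 0 ≤ β) :
    ContinuousOn (sphereIntegral (d := d) κ lam α β) (Metric.sphere 0 1) := by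
  obtain ⟨C, hC0, hC⟩ := exists_bound_sphereWeight (d := d) hκ hlam hα hβ norm_lastUnitVector
  refine continuousOn_of_dominated (bound := fun _ => C)
    (fun z _ => (integrable_sphereIntegrand hκ hlam hα hβ z).1) (fun z hz => .of_forall fun σ => ?_)
    (integrable_const C) (.of_forall fun σ => ?_)
  · have := hC z σ
    rw [← sphereIntegrand_eq_sphereWeight] at this
    simpa [mem_sphere_zero_iff_norm.1 hz] using this
  · unfold sphereIntegrand
    refine Continuous.continuousOn (continuous_const.mul ?_)
    exact Continuous.rpow_const (by fun_prop) fun _ => Or.inr hβ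

end SphereIntegral

/-! ### Directional norms of the kernel as sphere integrals. -/

section KernelNorm

variable {d : ℕ}

/-- The `q`-th power of the directional `L^q` norms of the gradient kernel, as sphere integrals. -/
lemma integral_abs_inner_singleLayerGradKernel {a : ℝ} (ha : 0 < a)
    {x : EuclideanSpace ℝ (Fin (d + 1))} (hx : 0 < x (Fin.last d)) {t : ℝ} (ht : 0 < t)
    {q κ lam α m : ℝ} (hq : 1 ≤ q) (hκ : κ = q * x (Fin.last d) ^ 2 / (4 * a ^ 2 * t))
    (hm : m = (((d + 1 : ℕ) : ℝ) + 2) * q / 2) (hlam : lam = m - 2)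
    (hα : α = (((d + 1 : ℕ) : ℝ) + 1) * q - (((d + 1 : ℕ) : ℝ) + 2))
    (z : EuclideanSpace ℝ (Fin (d + 1))) :
    ∫ w, |inner ℝ z (singleLayerGradKernel a x t w)| ^ q ∂(layerMeasure d t) =
      (((4 * a ^ 2 * Real.pi) ^ (((d + 1 : ℕ) : ℝ) / 2))⁻¹ ^ q * (q / (4 * a ^ 2)) ^ (1 - m) *
        x (Fin.last d) ^ (-(α + 1)) / 2) * sphereIntegral κ lam α q z := by
  have hq0 : 0 < q := by linarith
  set n : ℝ := ((d + 1 : ℕ) : ℝ) with hn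
  set h := x (Fin.last d) with hh
  set P := (4 * a ^ 2 * Real.pi) ^ (n / 2) with hP
  have hP0 : 0 < P := by positivity
  have hκ0 : 0 < κ := by rw [hκ]; positivity
  have hint : Integrable (fun w => |inner ℝ z (singleLayerGradKernel a x t w)| ^ q)
      (layerMeasure d t) := by
    have h1 : MemLp (fun w => inner ℝ z (singleLayerGradKernel a x t w)) (ENNReal.ofReal q)
        (layerMeasure d t) :=
      (memLp_singleLayerGradKernel ha hx ht (by simpa using hq)).const_inner z
    have := h1.integrable_norm_rpow (by simpa using hq0) (by simp)
    simpa only [ENNReal.toReal_ofReal hq0.le, Real.norm_eq_abs] using this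
  rw [layerMeasure_eq_prod] at hint ⊢
  rw [integral_prod _ hint]
  set x' : EuclideanSpace ℝ (Fin d) := WithLp.toLp 2 (fun i : Fin d => x i.castSucc) with hx'
  have inner_eq : ∀ y : EuclideanSpace ℝ (Fin d),
      ∫ τ in Ioo 0 t, |inner ℝ z (singleLayerGradKernel a x t (y, τ))| ^ q =
        (2 * (P⁻¹ ^ q * (q / (4 * a ^ 2)) ^ (1 - m) * h ^ (-(α + 1)) / 2)) *
          (sphereWeight κ lam α q (lastUnitVector d) z (snocPoint (x' - y) h) *
            (h / ‖snocPoint (x' - y) h‖ ^ (d + 1))) := by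
    intro y
    set X := snocPoint (x' - y) h with hX
    set r := ‖X‖ with hr
    have hr0 : 0 < r := by rw [hr, hX, norm_snocPoint]; positivity
    -- The `q`-th power of the Gaussian is `exp (-b/(t-τ))`, and `b/t = κ/(h/r)²`, where `h/r` is
    -- the cosine of the angle between `x - y` and `e_n`.
    set b := q * r ^ 2 / (4 * a ^ 2) with hb
    have hb0 : 0 < b := by positivity
    have h1 : ∫ τ in Ioo 0 t, |inner ℝ z (singleLayerGradKernel a x t (y, τ))| ^ q =
        ∫ τ in Ioo 0 t, (P⁻¹ ^ q * |inner ℝ z X| ^ q) *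
          (Real.exp (-(b / (t - τ))) / (t - τ) ^ m) := by
      refine setIntegral_congr_fun measurableSet_Ioo fun τ hτ => ?_
      have hs : 0 < t - τ := by linarith [hτ.2]
      simp only [singleLayerGradKernel, sub_boundaryPoint, ← hx', ← hh, ← hX, ← hn, ← hP, ← hr]
      set s := t - τ
      have hcoef : 2 * a ^ 2 / P * (Real.exp (-r ^ 2 / (4 * a ^ 2 * s)) / s ^ (n / 2)) /
          (2 * a ^ 2 * s) = P⁻¹ * (Real.exp (-r ^ 2 / (4 * a ^ 2 * s)) / s ^ (n / 2 + 1)) := by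
        rw [Real.rpow_add_one hs.ne']; field_simp
      rw [hcoef, real_inner_smul_right, abs_mul, abs_of_pos (by positivity : 0 < P⁻¹ * (_ / _)),
        Real.mul_rpow (by positivity) (abs_nonneg _), Real.mul_rpow (by positivity) (by positivity),
        Real.div_rpow (by positivity) (by positivity), ← Real.exp_mul, ← Real.rpow_mul hs.le,
        show (n / 2 + 1) * q = m by rw [hm]; ring,
        show -r ^ 2 / (4 * a ^ 2 * s) * q = -(b / s) by rw [hb]; field_simp]
      ring
    rw [h1, integral_const_mul, setIntegral_time_eq hb0 ht]
    have hgw : ∫ ξ in Ioi (b / t), ξ ^ (m - 2) * Real.exp (-ξ) = gammaWeight κ lam (h / r) := by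
      rw [gammaWeight, hlam, hκ, hb]
      congr 3
      field_simp
    have hbm : b ^ (1 - m) = (q / (4 * a ^ 2)) ^ (1 - m) * r ^ (2 * (1 - m)) := by
      rw [Real.rpow_mul hr0.le, Real.rpow_two, ← Real.mul_rpow (by positivity) (by positivity)]
      congr 1
      rw [hb]; ring
    rw [hgw, hbm, sphereWeight, inner_lastUnitVector, hX, snocPoint_last, ← hX, ← hr,
      abs_of_pos (by positivity : 0 < h / r), abs_div, abs_of_pos hr0, real_inner_comm z X,
      Real.div_rpow hx.le hr0.le, Real.div_rpow (abs_nonneg _) hr0.le]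
    have hh1 : h ^ (-(α + 1)) * (h ^ α * h) = 1 := by
      rw [← Real.rpow_add_one hx.ne', ← Real.rpow_add hx, neg_add_cancel, Real.rpow_zero]
    -- The exponent `α` is exactly the one for which all powers of `r` combine into the Jacobian `h
    -- / r^(d+1)` of central projection.
    have hr1 : r ^ (2 * (1 - m)) * (r ^ α * r ^ q * r ^ (d + 1)) = 1 := by
      rw [← Real.rpow_natCast, ← Real.rpow_add hr0, ← Real.rpow_add hr0, ← Real.rpow_add hr0, ← hn,
        show 2 * (1 - m) + (α + q + n) = 0 by rw [hm, hα]; ring, Real.rpow_zero]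
    have hr2 : r ^ (2 * (1 - m)) = 1 / (r ^ α * r ^ q * r ^ (d + 1)) := by
      rw [eq_div_iff (by positivity), hr1]
    rw [hr2]
    calc _ = (P⁻¹ ^ q * |inner ℝ z X| ^ q * (q / (4 * a ^ 2)) ^ (1 - m) * gammaWeight κ lam (h / r) *
          (1 / (r ^ α * r ^ q * r ^ (d + 1)))) * (h ^ (-(α + 1)) * (h ^ α * h)) := by
            rw [hh1]; ring
      _ = _ := by field_simp
  simp_rw [inner_eq]
  rw [integral_const_mul,
    integral_sub_left_eq_self (fun v => sphereWeight κ lam α q (lastUnitVector d) z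
      (snocPoint v h) * (h / ‖snocPoint v h‖ ^ (d + 1))) volume x']
  have key := integral_sphere_eq_hyperplane (measurable_sphereWeight κ lam α q (lastUnitVector d) z)
    (sphereWeight_nonneg hκ0.le lam α q (lastUnitVector d) z)
    (sphereWeight_smul κ lam α q (lastUnitVector d) z) hx
  rw [sphereIntegral]
  simp only [sphereIntegrand_eq_sphereWeight]
  rw [key]
  ring

end KernelNorm

/-! ### The maximum at the normal direction. -/

section MaximumDirection

variable {d : ℕ}

/-- If the weight is a nondecreasing function of `|(σ, e_n)|`, then the sphere integral is largest
in the direction `e_n`. -/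
lemma isMaxOn_sphereIntegral_lastUnitVector {κ lam α β : ℝ} (hκ : 0 < κ) (hlam : -1 < lam)
    (hα : 0 < α) (hβ : 0 < β) :
    IsMaxOn (sphereIntegral (d := d) κ lam α β) (Metric.sphere 0 1) (lastUnitVector d) := by
  intro z hz
  have hz1 : ‖z‖ = 1 := mem_sphere_zero_iff_norm.1 hz
  set e := lastUnitVector d with he
  have he1 : ‖e‖ = 1 := norm_lastUnitVector
  set J : EuclideanSpace ℝ (Fin (d + 1)) → EuclideanSpace ℝ (Fin (d + 1)) → ℝ := fun y v =>
    ∫ σ : Metric.sphere (0 : EuclideanSpace ℝ (Fin (d + 1))) 1, sphereWeight κ lam α β y v σ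
      ∂(surfaceMeasure (d + 1)) with hJ
  -- This reflection exchanges `e` and `z`, so invariance gives `J z z = J e e` and `J z e = J e z`;
  -- the inequality `hsum` then says `2 J e z ≤ 2 J e e`.
  set R := (ℝ ∙ (e - z))ᗮ.reflection with hR
  have hRe : R e = z := Submodule.reflection_sub (he1.trans hz1.symm)
  have hRz : R z = e := by rw [← hRe]; exact Submodule.reflection_reflection _ e
  have hinv : ∀ y v, J (R y) (R v) = J y v := by
    intro y v
    have hcomp : ∀ X, sphereWeight κ lam α β (R y) (R v) (R X) = sphereWeight κ lam α β y v X := by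
      intro X
      simp only [sphereWeight, LinearIsometryEquiv.inner_map_map, LinearIsometryEquiv.norm_map]
    have h1 := lintegral_sphere_comp_linearIsometryEquiv
      (G := fun X => ENNReal.ofReal (sphereWeight κ lam α β (R y) (R v) X))
      (measurable_sphereWeight κ lam α β (R y) (R v)).ennreal_ofReal
      (fun c hc X => by rw [sphereWeight_smul _ _ _ _ _ _ c hc]) R
    simp only [hcomp] at h1
    simp only [hJ]
    rw [integral_eq_lintegral_of_nonneg_ae, integral_eq_lintegral_of_nonneg_ae, h1]
    · exact .of_forall fun σ => sphereWeight_nonneg hκ.le ..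
    · exact ((measurable_sphereWeight κ lam α β _ _).comp
        measurable_subtype_coe).aestronglyMeasurable
    · exact .of_forall fun σ => sphereWeight_nonneg hκ.le ..
    · exact ((measurable_sphereWeight κ lam α β _ _).comp
        measurable_subtype_coe).aestronglyMeasurable
  have hint : ∀ y : EuclideanSpace ℝ (Fin (d + 1)), ‖y‖ = 1 → ∀ v,
      Integrable (fun σ : Metric.sphere (0 : EuclideanSpace ℝ (Fin (d + 1))) 1 =>
        sphereWeight κ lam α β y v σ) (surfaceMeasure (d + 1)) := fun y hy v =>
    integrable_sphereWeight hκ hlam (by linarith) hβ.le hy v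
  have hsum : J e z + J z e ≤ J e e + J z z := by
    simp only [hJ]
    rw [← integral_add (hint e he1 z) (hint z hz1 e), ← integral_add (hint e he1 e) (hint z hz1 z)]
    refine integral_mono ((hint e he1 z).add (hint z hz1 e)) ((hint e he1 e).add (hint z hz1 z))
      fun σ => ?_
    simp only [sphereWeight, norm_eq_of_mem_sphere, div_one]
    -- With `F u` the weight times `|u|^α`, this is `(F v - F u)(|v|^β - |u|^β) ≥ 0`. At `u = 0`, `α
    -- > 0` forces `F 0 = 0` despite the conventional value of the weight there.
    have mono : ∀ u v : ℝ, |u| ≤ |v| →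
        gammaWeight κ lam u * |u| ^ α * |v| ^ β + gammaWeight κ lam v * |v| ^ α * |u| ^ β ≤
        gammaWeight κ lam u * |u| ^ α * |u| ^ β + gammaWeight κ lam v * |v| ^ α * |v| ^ β := by
      intro u v huv
      have hb : |u| ^ β ≤ |v| ^ β := by gcongr
      have hv := gammaWeight_nonneg (lam := lam) hκ.le v
      have hF : gammaWeight κ lam u * |u| ^ α ≤ gammaWeight κ lam v * |v| ^ α := by
        rcases eq_or_ne u 0 with h0 | h0
        · rw [h0, abs_zero, Real.zero_rpow hα.ne', mul_zero]
          positivity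
        · gcongr
          exact gammaWeight_le_of_abs_le hκ.le hlam h0 huv
      linarith [mul_nonneg (sub_nonneg.2 hF) (sub_nonneg.2 hb)]
    set u := inner ℝ (σ : EuclideanSpace ℝ (Fin (d + 1))) e
    set v := inner ℝ (σ : EuclideanSpace ℝ (Fin (d + 1))) z
    rcases le_total |u| |v| with h | h
    · exact mono u v h
    · have := mono v u h
      linarith
  have h1 : J z z = J e e := by rw [← hRe, hinv]
  have h2 : J z e = J e z := by
    have := hinv e z
    rwa [hRe, hRz] at this
  have hI : ∀ v, sphereIntegral κ lam α β v = J e v := fun v => by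
    simp only [sphereIntegral, sphereIntegrand_eq_sphereWeight, hJ, he]
  show sphereIntegral κ lam α β z ≤ sphereIntegral κ lam α β e
  rw [hI, hI]
  linarith

end MaximumDirection

/-! ### The sphere integral at `e_n` in the polar angle. -/

section ExplicitFormula

variable {d : ℕ}

lemma image_tan_Ioo : Real.tan '' Ioo 0 (Real.pi / 2) = Ioi 0 := by
  ext y
  simp only [mem_image, mem_Ioo, mem_Ioi]
  constructor
  · rintro ⟨θ, ⟨h1, h2⟩, rfl⟩
    exact Real.tan_pos_of_pos_of_lt_pi_div_two h1 h2
  · intro hy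
    exact ⟨Real.arctan y, ⟨Real.arctan_pos.2 hy, Real.arctan_lt_pi_div_two y⟩, Real.tan_arctan y⟩

lemma setIntegral_Ioi_eq_tan (F : ℝ → ℝ) :
    ∫ ρ in Ioi (0 : ℝ), F ρ =
      ∫ θ in Ioo 0 (Real.pi / 2), 1 / Real.cos θ ^ 2 * F (Real.tan θ) := by
  have hcos : ∀ θ ∈ Ioo 0 (Real.pi / 2), 0 < Real.cos θ := fun θ hθ =>
    Real.cos_pos_of_mem_Ioo ⟨by linarith [hθ.1, Real.pi_pos], hθ.2⟩
  rw [← image_tan_Ioo, integral_image_eq_integral_abs_deriv_smul measurableSet_Ioo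
    (fun θ hθ => (Real.hasDerivAt_tan (hcos θ hθ).ne').hasDerivWithinAt)]
  · refine setIntegral_congr_fun measurableSet_Ioo fun θ hθ => ?_
    simp only [smul_eq_mul]
    rw [abs_of_nonneg (by positivity)]
  · exact Real.injOn_tan.mono (Ioo_subset_Ioo_left (by linarith [Real.pi_pos]))

/-- Projected to the hyperplane at height 1, the integrand is radial. Polar coordinates in `ℝ^d` and
`ρ = tan θ` finish, `θ` being the angle with `e_n` and `cos θ = 1/√(ρ²+1)`. -/
lemma sphereIntegral_lastUnitVector {κ lam α β : ℝ} (hd : 1 ≤ d) (hκ : 0 < κ) :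
    sphereIntegral (d := d) κ lam α β (lastUnitVector d) =
      2 * sphereArea d * ∫ θ in (0 : ℝ)..(Real.pi / 2),
        (∫ ξ in Ioi (κ / Real.cos θ ^ 2), ξ ^ lam * Real.exp (-ξ)) *
          Real.cos θ ^ (α + β) * Real.sin θ ^ (d - 1) := by
  have : Nonempty (Fin d) := ⟨⟨0, hd⟩⟩
  have key := integral_sphere_eq_hyperplane
    (measurable_sphereWeight κ lam α β (lastUnitVector d) (lastUnitVector d))
    (sphereWeight_nonneg hκ.le lam α β (lastUnitVector d) (lastUnitVector d))
    (sphereWeight_smul κ lam α β (lastUnitVector d) (lastUnitVector d)) one_pos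
  rw [sphereIntegral]
  simp only [sphereIntegrand_eq_sphereWeight]
  rw [key]
  set f : ℝ → ℝ := fun ρ => gammaWeight κ lam (1 / √(ρ ^ 2 + 1)) * (1 / √(ρ ^ 2 + 1)) ^ α *
    (1 / √(ρ ^ 2 + 1)) ^ β * (1 / √(ρ ^ 2 + 1) ^ (d + 1)) with hf
  have h1 : ∀ v : EuclideanSpace ℝ (Fin d),
      sphereWeight κ lam α β (lastUnitVector d) (lastUnitVector d) (snocPoint v 1) *
        (1 / ‖snocPoint v 1‖ ^ (d + 1)) = f ‖v‖ := by
    intro v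
    simp only [sphereWeight, inner_lastUnitVector, snocPoint_last, norm_snocPoint, one_pow, hf]
    rw [abs_of_nonneg (by positivity : 0 ≤ 1 / √(‖v‖ ^ 2 + 1))]
  simp_rw [h1]
  rw [integral_fun_norm_addHaar, finrank_euclideanSpace_fin]
  have harea : sphereArea d = d * (volume : Measure (EuclideanSpace ℝ (Fin d))).real
      (Metric.ball 0 1) := by
    rw [sphereArea, surfaceMeasure, Measure.toSphere_real_apply_univ, finrank_euclideanSpace_fin]
  rw [setIntegral_Ioi_eq_tan, harea, intervalIntegral.integral_of_le (by positivity),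
    integral_Ioc_eq_integral_Ioo, nsmul_eq_mul, smul_eq_mul]
  have h2 : ∫ θ in Ioo 0 (Real.pi / 2), 1 / Real.cos θ ^ 2 *
        (Real.tan θ ^ (d - 1) • f (Real.tan θ)) =
      ∫ θ in Ioo 0 (Real.pi / 2),
        (∫ ξ in Ioi (κ / Real.cos θ ^ 2), ξ ^ lam * Real.exp (-ξ)) *
          Real.cos θ ^ (α + β) * Real.sin θ ^ (d - 1) := by
    refine setIntegral_congr_fun measurableSet_Ioo fun θ hθ => ?_
    have hcos : 0 < Real.cos θ :=
      Real.cos_pos_of_mem_Ioo ⟨by linarith [hθ.1, Real.pi_pos], hθ.2⟩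
    have hsq : √(Real.tan θ ^ 2 + 1) = 1 / Real.cos θ := by
      rw [add_comm, ← Real.inv_sqrt_one_add_tan_sq hcos, one_div, inv_inv]
    simp only [hf, hsq, one_div_one_div, smul_eq_mul, gammaWeight]
    obtain ⟨k, rfl⟩ : ∃ k, d = k + 1 := ⟨d - 1, by omega⟩
    rw [Real.rpow_add hcos, Real.tan_eq_sin_div_cos, Nat.add_sub_cancel, div_pow, div_pow, one_pow,
      one_div_one_div]
    field_simp
    ring
  rw [h2]
  ring

lemma sphereArea_eq (hd : 1 ≤ d) :
    sphereArea d = 2 * Real.pi ^ ((d : ℝ) / 2) / Real.Gamma ((d : ℝ) / 2) := by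
  have : Nonempty (Fin d) := ⟨⟨0, hd⟩⟩
  have hd0 : (0 : ℝ) < d := by exact_mod_cast hd
  have hG := Real.Gamma_pos_of_pos (by positivity : 0 < (d : ℝ) / 2)
  rw [sphereArea, surfaceMeasure, Measure.toSphere_real_apply_univ, finrank_euclideanSpace_fin,
    Measure.real, EuclideanSpace.volume_ball, Real.Gamma_add_one (by positivity)]
  simp only [Fintype.card_fin, ENNReal.ofReal_one, one_pow, one_mul]
  rw [ENNReal.toReal_ofReal (by positivity), Real.sqrt_eq_rpow, ← Real.rpow_natCast,
    ← Real.rpow_mul Real.pi_pos.le, one_div_mul_eq_div]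
  field_simp

end ExplicitFormula

/-! ### Matching the constants. -/

section Constants

/-- Taking logarithms reduces the identity to linear algebra in the logs. Writing `1 - 1/q` for
`1/p` lets one formula cover `q = 1`, that is `p = ∞`. -/
lemma coefficient_rpow_inv {a h q m α n : ℝ} (ha : 0 < a) (hh : 0 < h) (hq : 1 ≤ q)
    (hm : m = (n + 2) * q / 2) (hα : α = (n + 1) * q - (n + 2)) :
    (((4 * a ^ 2 * Real.pi) ^ (n / 2))⁻¹ ^ q * (q / (4 * a ^ 2)) ^ (1 - m) *
      h ^ (-(α + 1)) / 2) ^ (1 / q) =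
    2 ^ (3 * (1 - 1 / q) - 1) * a ^ (2 * (1 - 1 / q)) /
      (Real.pi ^ (n / 2) * q ^ (n / 2 + (1 - 1 / q))) / h ^ ((n + 1) * (1 - 1 / q)) := by
  have hq0 : 0 < q := by linarith
  have hπ := Real.pi_pos
  refine Real.log_injOn_pos (mem_Ioi.2 (by positivity)) (mem_Ioi.2 (by positivity)) ?_
  have h4 : Real.log 4 = 2 * Real.log 2 := by
    rw [show (4 : ℝ) = 2 ^ 2 by norm_num, Real.log_pow]; norm_num
  have e1 : Real.log (4 * a ^ 2 * Real.pi) = 2 * Real.log 2 + 2 * Real.log a + Real.log Real.pi := by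
    rw [Real.log_mul (by positivity) (by positivity), Real.log_mul (by positivity) (by positivity),
      h4, Real.log_pow]; norm_num
  have e2 : Real.log (q / (4 * a ^ 2)) = Real.log q - (2 * Real.log 2 + 2 * Real.log a) := by
    rw [Real.log_div (by positivity) (by positivity), Real.log_mul (by positivity) (by positivity),
      h4, Real.log_pow]; norm_num
  rw [Real.log_rpow (by positivity), Real.log_div (by positivity) (by positivity),
    Real.log_mul (by positivity) (by positivity), Real.log_mul (by positivity) (by positivity),
    Real.log_rpow (by positivity), Real.log_inv, Real.log_rpow (by positivity),
    Real.log_rpow (by positivity), Real.log_rpow hh, e1, e2,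
    Real.log_div (by positivity) (by positivity), Real.log_div (by positivity) (by positivity),
    Real.log_mul (by positivity) (by positivity), Real.log_mul (by positivity) (by positivity),
    Real.log_rpow two_pos, Real.log_rpow ha, Real.log_rpow hπ, Real.log_rpow hq0,
    Real.log_rpow hh, hm, hα]
  field_simp
  ring

lemma bConst_eq {d : ℕ} (hd : 1 ≤ d) {a : ℝ} (ha : 0 < a) :
    bConst (d + 1) a = kConst (d + 1) a 2 * √(2 * sphereArea d) := by
  have hd0 : (0 : ℝ) < d := by exact_mod_cast hd
  have hG := Real.Gamma_pos_of_pos (by positivity : 0 < (d : ℝ) / 2)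
  have hπ := Real.pi_pos
  rw [bConst, kConst, sphereArea_eq hd]
  push_cast
  rw [add_sub_cancel_right]
  rw [Real.sqrt_eq_rpow, Real.sqrt_eq_rpow]
  refine Real.log_injOn_pos (mem_Ioi.2 (by positivity)) (mem_Ioi.2 (by positivity)) ?_
  have e1 : Real.log (2 * Real.pi ^ ((d : ℝ) / 2) / Real.Gamma ((d : ℝ) / 2)) =
      Real.log 2 + d / 2 * Real.log Real.pi - Real.log (Real.Gamma ((d : ℝ) / 2)) := by
    rw [Real.log_div (by positivity) (by positivity), Real.log_mul (by positivity) (by positivity),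
      Real.log_rpow hπ]
  have e2 : Real.log (Real.pi ^ (((d : ℝ) + 1) / 2) * (2 / (2 - 1)) ^ (((d : ℝ) + 1) / 2 + 1 / 2)) =
      (d + 1) / 2 * Real.log Real.pi + ((d + 1) / 2 + 1 / 2) * Real.log 2 := by
    norm_num only
    rw [Real.log_mul (by positivity) (by positivity), Real.log_rpow hπ, Real.log_rpow two_pos]
  rw [Real.log_div (by positivity) (by positivity), Real.log_mul (by positivity) (by positivity),
    Real.log_mul (by positivity) (by positivity), Real.log_rpow two_pos, Real.log_rpow hπ,
    Real.log_rpow hG, Real.log_mul (by positivity) (by positivity),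
    Real.log_div (by positivity) (by positivity), e2,
    Real.log_mul (by positivity) (by positivity), Real.log_rpow two_pos, Real.log_rpow ha,
    Real.log_rpow (by positivity), Real.log_mul (by positivity) (by positivity), e1]
  ring

end Constants

/-! ### From kernel norms to the sharp coefficient. -/

section Sharpness

variable {d : ℕ}

/-- The normal component of `K` is strictly positive, because that of `x - y` is `x_n`. Hence the
maximal directional norm is positive, as the extremal construction requires. -/
lemma toReal_eLpNorm_inner_lastUnitVector_pos {a : ℝ} (ha : 0 < a)
    {x : EuclideanSpace ℝ (Fin (d + 1))} (hx : 0 < x (Fin.last d)) {t : ℝ} (ht : 0 < t)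
    {q : ℝ≥0∞} (hq : 1 ≤ q) :
    0 < (eLpNorm (fun w => inner ℝ (lastUnitVector d) (singleLayerGradKernel a x t w)) q
      (layerMeasure d t)).toReal := by
  have hm := (memLp_singleLayerGradKernel ha hx ht hq (d := d)).const_inner (𝕜 := ℝ)
    (lastUnitVector d)
  refine ENNReal.toReal_pos (fun h0 => ?_) hm.2.ne
  rw [eLpNorm_eq_zero_iff hm.1 (by positivity)] at h0
  have hne : NeZero (layerMeasure d t) := by
    refine ⟨?_⟩
    rw [← Measure.measure_univ_ne_zero, layerMeasure_eq_prod, ← univ_prod_univ,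
      Measure.prod_prod]
    simp [ht, NeZero.ne]
  obtain ⟨w, hw1, hw2⟩ := (h0.and (ae_layerMeasure t)).exists
  have hs : 0 < t - w.2 := by linarith [hw2.2]
  simp only [singleLayerGradKernel, real_inner_smul_right] at hw1
  rw [real_inner_comm, inner_lastUnitVector, sub_boundaryPoint, snocPoint_last] at hw1
  exact absurd hw1 (by simp only [Pi.zero_apply]; positivity)

/-- The sharp coefficient is the largest directional norm of the gradient kernel. -/
lemma isSharpGradientCoeff_of_isGreatest {a : ℝ} (ha : 0 < a)
    {x : EuclideanSpace ℝ (Fin (d + 1))} (hx : 0 < x (Fin.last d)) {t : ℝ} (ht : 0 < t)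
    {p : ℝ≥0∞} {q : ℝ} (hq : 1 ≤ q) [hpq : p.HolderConjugate (ENNReal.ofReal q)] {M : ℝ}
    (hM : IsGreatest ((fun z : EuclideanSpace ℝ (Fin (d + 1)) =>
      (eLpNorm (fun w => inner ℝ z (singleLayerGradKernel a x t w)) (ENNReal.ofReal q)
        (layerMeasure d t)).toReal) '' Metric.sphere 0 1) M) :
    IsSharpGradientCoeff a p x t M := by
  have hq1 : 1 ≤ ENNReal.ofReal q := by simpa using hq
  have hK := memLp_singleLayerGradKernel (d := d) ha hx ht hq1
  have hsub : ∀ g : EuclideanSpace ℝ (Fin d) × ℝ → ℝ, IsBoundaryDatum p g →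
      MemLp g p (layerMeasure d t) := fun g hg =>
    hg.mono_measure (Measure.restrict_mono (prod_mono_right Ioo_subset_Ioi_self) le_rfl)
  have hpos := toReal_eLpNorm_inner_lastUnitVector_pos (d := d) ha hx ht hq1
  have hM0 : 0 < M := hpos.trans_le
    (hM.2 ⟨lastUnitVector d, mem_sphere_zero_iff_norm.2 norm_lastUnitVector, rfl⟩)
  obtain ⟨⟨z, hz, hzM⟩, hMax⟩ := hM
  have hgrad : ∀ g : EuclideanSpace ℝ (Fin d) × ℝ → ℝ, IsBoundaryDatum p g →
      gradient (fun ξ => singleLayer a g ξ t) x =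
        ∫ w, g w • singleLayerGradKernel a x t w ∂(layerMeasure d t) := fun g hg =>
    (hasGradientAt_singleLayer ha hx ht (hsub g hg) (q := ENNReal.ofReal q)).gradient
  refine ⟨fun g hg => ⟨integrable_singleLayerIntegrand ha hx ht (hsub g hg)
    (q := ENNReal.ofReal q), (hasGradientAt_singleLayer ha hx ht (hsub g hg)
    (q := ENNReal.ofReal q)).differentiableAt⟩, fun g hg => ?_, fun C hC => ?_⟩
  · rw [hgrad g hg]
    exact norm_integral_smul_le_of_forall_unit (hsub g hg) hK hM0.le
      fun y hy => hMax ⟨y, mem_sphere_zero_iff_norm.2 hy, rfl⟩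
  · rw [← hzM]
    refine le_of_forall_norm_integral_smul_le (p := p) hq hK (mem_sphere_zero_iff_norm.1 hz)
      (by simp only at hzM; rw [hzM]; exact hM0) fun g hg => ?_
    -- Data live on all positive times but the norm sees only `(0,t)`; a test function on `(0,t)` is
    -- extended by zero.
    set S := (univ : Set (EuclideanSpace ℝ (Fin d))) ×ˢ Ioo (0 : ℝ) t with hS
    have hSm : MeasurableSet S := MeasurableSet.univ.prod measurableSet_Ioo
    have hd : IsBoundaryDatum p (S.indicator g) := by
      have : MemLp (S.indicator g) p volume := (memLp_indicator_iff_restrict hSm).2 hg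
      exact this.restrict _
    have hae : S.indicator g =ᵐ[layerMeasure d t] g := indicator_ae_eq_restrict hSm
    have h1 := hC _ hd
    rw [hgrad _ hd] at h1
    have h2 : ∫ w, S.indicator g w • singleLayerGradKernel a x t w ∂(layerMeasure d t) =
        ∫ w, g w • singleLayerGradKernel a x t w ∂(layerMeasure d t) := by
      refine integral_congr_ae ?_
      filter_upwards [hae] with w hw
      rw [hw]
    have h3 : boundaryNorm p t (S.indicator g) = (eLpNorm g p (layerMeasure d t)).toReal := by
      rw [boundaryNorm, ← eLpNorm_congr_ae hae, layerMeasure]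
    rwa [h2, h3] at h1

/-- The sharp coefficient in terms of the maximum of the sphere integral. -/
lemma isSharpGradientCoeff_of_sphereIntegral {a : ℝ} (ha : 0 < a)
    {x : EuclideanSpace ℝ (Fin (d + 1))} (hx : 0 < x (Fin.last d)) {t : ℝ} (ht : 0 < t)
    {p : ℝ≥0∞} {q κ lam α : ℝ} (hq : 1 ≤ q) [hpq : p.HolderConjugate (ENNReal.ofReal q)]
    (hκ : κ = q * x (Fin.last d) ^ 2 / (4 * a ^ 2 * t))
    (hlam : lam = (((d + 1 : ℕ) : ℝ) + 2) * q / 2 - 2)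
    (hα : α = (((d + 1 : ℕ) : ℝ) + 1) * q - (((d + 1 : ℕ) : ℝ) + 2))
    {z : EuclideanSpace ℝ (Fin (d + 1))} (hz : ‖z‖ = 1)
    (hmax : IsMaxOn (sphereIntegral κ lam α q) (Metric.sphere 0 1) z) :
    IsSharpGradientCoeff a p x t
      (2 ^ (3 * (1 - 1 / q) - 1) * a ^ (2 * (1 - 1 / q)) /
        (Real.pi ^ (((d + 1 : ℕ) : ℝ) / 2) * q ^ (((d + 1 : ℕ) : ℝ) / 2 + (1 - 1 / q))) /
        x (Fin.last d) ^ ((((d + 1 : ℕ) : ℝ) + 1) * (1 - 1 / q)) *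
        sphereIntegral κ lam α q z ^ (1 / q)) := by
  have hq0 : 0 < q := by linarith
  have hκ0 : 0 ≤ κ := by rw [hκ]; positivity
  have hnorm : ∀ y : EuclideanSpace ℝ (Fin (d + 1)),
      (eLpNorm (fun w => inner ℝ y (singleLayerGradKernel a x t w)) (ENNReal.ofReal q)
        (layerMeasure d t)).toReal =
      2 ^ (3 * (1 - 1 / q) - 1) * a ^ (2 * (1 - 1 / q)) /
        (Real.pi ^ (((d + 1 : ℕ) : ℝ) / 2) * q ^ (((d + 1 : ℕ) : ℝ) / 2 + (1 - 1 / q))) /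
        x (Fin.last d) ^ ((((d + 1 : ℕ) : ℝ) + 1) * (1 - 1 / q)) *
        sphereIntegral κ lam α q y ^ (1 / q) := by
    intro y
    rw [toReal_eLpNorm_ofReal hq0 ((memLp_singleLayerGradKernel ha hx ht
      (by simpa using hq)).const_inner y),
      integral_abs_inner_singleLayerGradKernel ha hx ht hq hκ rfl hlam hα y,
      Real.mul_rpow (by positivity) (sphereIntegral_nonneg hκ0 y),
      coefficient_rpow_inv ha hx hq rfl hα]
  refine isSharpGradientCoeff_of_isGreatest ha hx ht hq (p := p)
    ⟨⟨z, mem_sphere_zero_iff_norm.2 hz, hnorm z⟩, ?_⟩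
  rintro _ ⟨y, hy, rfl⟩
  simp only [hnorm]
  have := sphereIntegral_nonneg (lam := lam) (α := α) (β := q) hκ0 y
  gcongr
  exact hmax hy

lemma exists_isMaxOn_sphereIntegral {κ lam α β : ℝ} (hκ : 0 < κ) (hlam : -1 < lam) (hα : -2 ≤ α)
    (hβ : 0 ≤ β) : ∃ z : EuclideanSpace ℝ (Fin (d + 1)), ‖z‖ = 1 ∧
      IsMaxOn (sphereIntegral κ lam α β) (Metric.sphere 0 1) z := by
  obtain ⟨z, hz, hmax⟩ := (isCompact_sphere (0 : EuclideanSpace ℝ (Fin (d + 1))) 1).exists_isMaxOn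
    ⟨lastUnitVector d, mem_sphere_zero_iff_norm.2 norm_lastUnitVector⟩
    (continuousOn_sphereIntegral (d := d) hκ hlam hα hβ)
  exact ⟨z, mem_sphere_zero_iff_norm.1 hz, hmax⟩

end Sharpness

/-! ### Rewriting the coefficient in terms of a finite `p`. -/

section FiniteExponent

variable {d : ℕ}

lemma isSharpGradientCoeff_kConst {a : ℝ} (ha : 0 < a)
    {x : EuclideanSpace ℝ (Fin (d + 1))} (hx : 0 < x (Fin.last d)) {t : ℝ} (ht : 0 < t)
    {p q κ lam α : ℝ} (hp : 1 < p) (hq : q = p / (p - 1))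
    (hκ : κ = q * x (Fin.last d) ^ 2 / (4 * a ^ 2 * t))
    (hlam : lam = (((d + 1 : ℕ) : ℝ) + 2) * q / 2 - 2)
    (hα : α = (((d + 1 : ℕ) : ℝ) - p + 2) / (p - 1))
    {z : EuclideanSpace ℝ (Fin (d + 1))} (hz : ‖z‖ = 1)
    (hmax : IsMaxOn (sphereIntegral κ lam α q) (Metric.sphere 0 1) z) :
    IsSharpGradientCoeff a (ENNReal.ofReal p) x t
      (kConst (d + 1) a p / x (Fin.last d) ^ ((((d + 1 : ℕ) : ℝ) + 1) / p) *
        sphereIntegral κ lam α q z ^ ((p - 1) / p)) := by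
  have hp1 : 0 < p - 1 := by linarith
  have hconj : p.HolderConjugate q := (Real.holderConjugate_iff_eq_conjExponent hp).2 hq
  have : (ENNReal.ofReal p).HolderConjugate (ENNReal.ofReal q) := hconj.ennrealOfReal
  have hα' : α = (((d + 1 : ℕ) : ℝ) + 1) * q - (((d + 1 : ℕ) : ℝ) + 2) := by
    rw [hα, hq]; field_simp; ring
  have hq1 : 1 / q = (p - 1) / p := by rw [hq, one_div_div]
  have hθ : 1 - 1 / q = 1 / p := by rw [hq1]; field_simp; ring
  have key := isSharpGradientCoeff_of_sphereIntegral ha hx ht (p := ENNReal.ofReal p)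
    hconj.symm.lt.le hκ hlam hα' hz hmax
  rw [hθ, hq1, show 3 * (1 / p) - 1 = (3 - p) / p by field_simp, mul_one_div, mul_one_div, hq]
    at key
  rw [kConst, ← hq]
  rwa [← hq] at key

end FiniteExponent

/-! ### The theorem: general, limiting and explicit cases. -/

theorem mainTheorem2 (n d : ℕ) (hn : 2 ≤ n) (hd : n = d + 1) (a : ℝ) (ha : 0 < a)
    (x : EuclideanSpace ℝ (Fin (d + 1))) (hx : 0 < x (Fin.last d)) (t : ℝ) (ht : 0 < t) :
    -- general formula, `1 < p < ∞`
    (∀ p q κ lam α : ℝ, 1 < p → q = p / (p - 1) →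
      κ = q * x (Fin.last d) ^ 2 / (4 * a ^ 2 * t) →
      lam = ((n : ℝ) + 2) * q / 2 - 2 →
      α = ((n : ℝ) - p + 2) / (p - 1) →
      (∀ z : EuclideanSpace ℝ (Fin (d + 1)),
        Integrable (sphereIntegrand κ lam α q z) (surfaceMeasure (d + 1))) ∧
      ∃ M : ℝ,
        IsGreatest ((fun z : EuclideanSpace ℝ (Fin (d + 1)) =>
          sphereIntegral κ lam α q z ^ ((p - 1) / p)) '' Metric.sphere 0 1) M ∧
        IsSharpGradientCoeff a (ENNReal.ofReal p) x t
          (kConst n a p / x (Fin.last d) ^ (((n : ℝ) + 1) / p) * M)) ∧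
    -- general formula, `p = ∞`, `q = 1`
    (∀ κ lam : ℝ, κ = x (Fin.last d) ^ 2 / (4 * a ^ 2 * t) → lam = ((n : ℝ) + 2) / 2 - 2 →
      (∀ z : EuclideanSpace ℝ (Fin (d + 1)),
        Integrable (sphereIntegrand κ lam (-1) 1 z) (surfaceMeasure (d + 1))) ∧
      ∃ M : ℝ,
        IsGreatest (sphereIntegral κ lam (-1) 1 ''
          Metric.sphere (0 : EuclideanSpace ℝ (Fin (d + 1))) 1) M ∧
        IsSharpGradientCoeff a ∞ x t (1 / (2 * Real.pi ^ ((n : ℝ) / 2)) * M)) ∧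
    -- the maximum is attained at `e_n`, and the explicit formula, `2 ≤ p ≤ (n + 4) / 2`
    (∀ p q κ lam α : ℝ, 2 ≤ p → p ≤ ((n : ℝ) + 4) / 2 → q = p / (p - 1) →
      κ = q * x (Fin.last d) ^ 2 / (4 * a ^ 2 * t) →
      lam = ((n : ℝ) + 2) * q / 2 - 2 →
      α = ((n : ℝ) - p + 2) / (p - 1) →
      IsMaxOn (sphereIntegral κ lam α q) (Metric.sphere 0 1) (lastUnitVector d) ∧
      IsSharpGradientCoeff a (ENNReal.ofReal p) x t
        (kConst n a p / x (Fin.last d) ^ (((n : ℝ) + 1) / p) *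
          (2 * sphereArea (n - 1) *
            ∫ θ in (0 : ℝ)..(Real.pi / 2),
              (∫ ξ in Ioi (q * x (Fin.last d) ^ 2 / (4 * a ^ 2 * t * Real.cos θ ^ 2)),
                ξ ^ ((((n : ℝ) - 2) * p + 4) / (2 * (p - 1))) * Real.exp (-ξ)) *
              Real.cos θ ^ (((n : ℝ) + 2) / (p - 1)) * Real.sin θ ^ (n - 2)) ^
            ((p - 1) / p))) ∧
    -- the case `p = 2`
    IsSharpGradientCoeff a 2 x t
      (bConst n a / x (Fin.last d) ^ (((n : ℝ) + 1) / 2) *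
        √(∫ θ in (0 : ℝ)..(Real.pi / 2),
          (∫ ξ in Ioi (x (Fin.last d) ^ 2 / (2 * a ^ 2 * t * Real.cos θ ^ 2)),
            ξ ^ n * Real.exp (-ξ)) *
          Real.cos θ ^ (n + 2) * Real.sin θ ^ (n - 2))) := by
  subst hd
  have hd1 : 1 ≤ d := by omega
  have hd1' : (1 : ℝ) ≤ d := by exact_mod_cast hd1
  have hnd : ((d + 1 : ℕ) : ℝ) = d + 1 := by push_cast; ring
  have hq1 : ∀ p q : ℝ, 1 < p → q = p / (p - 1) → 1 < q := fun p q hp hq =>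
    ((Real.holderConjugate_iff_eq_conjExponent hp).2 hq).symm.lt
  have hparam : ∀ p q κ lam α : ℝ, 1 < p → q = p / (p - 1) →
      κ = q * x (Fin.last d) ^ 2 / (4 * a ^ 2 * t) →
      lam = (((d + 1 : ℕ) : ℝ) + 2) * q / 2 - 2 →
      α = (((d + 1 : ℕ) : ℝ) - p + 2) / (p - 1) → 0 < κ ∧ -1 < lam ∧ -2 ≤ α ∧ 0 < q := by
    intro p q κ lam α hp hq hκ hlam hα
    have h1 := hq1 p q hp hq
    have hp1 : 0 < p - 1 := by linarith
    refine ⟨by rw [hκ]; positivity, ?_, ?_, by linarith⟩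
    · rw [hlam, hnd]; nlinarith
    · rw [hα, le_div_iff₀ hp1, hnd]; linarith
  have explicit : ∀ p q κ lam α : ℝ, 2 ≤ p → p ≤ (((d + 1 : ℕ) : ℝ) + 4) / 2 → q = p / (p - 1) →
      κ = q * x (Fin.last d) ^ 2 / (4 * a ^ 2 * t) →
      lam = (((d + 1 : ℕ) : ℝ) + 2) * q / 2 - 2 →
      α = (((d + 1 : ℕ) : ℝ) - p + 2) / (p - 1) →
      IsMaxOn (sphereIntegral κ lam α q) (Metric.sphere 0 1) (lastUnitVector d) ∧
      IsSharpGradientCoeff a (ENNReal.ofReal p) x t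
        (kConst (d + 1) a p / x (Fin.last d) ^ ((((d + 1 : ℕ) : ℝ) + 1) / p) *
          (2 * sphereArea d *
            ∫ θ in (0 : ℝ)..(Real.pi / 2),
              (∫ ξ in Ioi (q * x (Fin.last d) ^ 2 / (4 * a ^ 2 * t * Real.cos θ ^ 2)),
                ξ ^ (((((d + 1 : ℕ) : ℝ) - 2) * p + 4) / (2 * (p - 1))) * Real.exp (-ξ)) *
              Real.cos θ ^ ((((d + 1 : ℕ) : ℝ) + 2) / (p - 1)) * Real.sin θ ^ (d - 1)) ^
            ((p - 1) / p)) := by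
    intro p q κ lam α hp2 hpn hq hκ hlam hα
    have hp : 1 < p := by linarith
    have hp1 : 0 < p - 1 := by linarith
    obtain ⟨hκ0, hlam1, -, hq0⟩ := hparam p q κ lam α hp hq hκ hlam hα
    -- The upper bound on `p` enters here: `(n+4)/2 < n+2`, so the numerator `n - p + 2` is
    -- positive.
    have hα0 : 0 < α := by
      rw [hα]
      rw [hnd] at hpn ⊢
      exact div_pos (by linarith) hp1
    have hmax := isMaxOn_sphereIntegral_lastUnitVector (d := d) hκ0 hlam1 hα0 hq0
    refine ⟨hmax, ?_⟩
    have key := isSharpGradientCoeff_kConst ha hx ht hp hq hκ hlam hα norm_lastUnitVector hmax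
    have hl : lam = ((((d + 1 : ℕ) : ℝ) - 2) * p + 4) / (2 * (p - 1)) := by
      rw [hlam, hq]; field_simp; ring
    have hαq : α + q = (((d + 1 : ℕ) : ℝ) + 2) / (p - 1) := by
      rw [hα, hq]; field_simp; ring
    rw [sphereIntegral_lastUnitVector hd1 hκ0, hαq] at key
    simpa only [hκ, div_div, hl] using key
  refine ⟨?_, ?_, ?_, ?_⟩
  · intro p q κ lam α hp hq hκ hlam hα
    obtain ⟨hκ0, hlam1, hα2, hq0⟩ := hparam p q κ lam α hp hq hκ hlam hα
    refine ⟨fun z => integrable_sphereIntegrand hκ0 hlam1 hα2 hq0.le z, ?_⟩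
    obtain ⟨z, hz, hmax⟩ := exists_isMaxOn_sphereIntegral (d := d) hκ0 hlam1 hα2 hq0.le
    refine ⟨sphereIntegral κ lam α q z ^ ((p - 1) / p),
      ⟨⟨z, mem_sphere_zero_iff_norm.2 hz, rfl⟩, ?_⟩,
      isSharpGradientCoeff_kConst ha hx ht hp hq hκ hlam hα hz hmax⟩
    rintro _ ⟨y, hy, rfl⟩
    exact Real.rpow_le_rpow (sphereIntegral_nonneg hκ0.le y) (hmax hy)
      (div_nonneg (by linarith) (by linarith))
  · intro κ lam hκ hlam
    have hκ0 : 0 < κ := by rw [hκ]; positivity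
    have hlam1 : -1 < lam := by rw [hlam, hnd]; linarith
    refine ⟨fun z => integrable_sphereIntegrand hκ0 hlam1 (by norm_num) zero_le_one z, ?_⟩
    obtain ⟨z, hz, hmax⟩ := exists_isMaxOn_sphereIntegral (d := d) hκ0 hlam1
      (by norm_num : (-2 : ℝ) ≤ -1) zero_le_one
    refine ⟨sphereIntegral κ lam (-1) 1 z, ⟨⟨z, mem_sphere_zero_iff_norm.2 hz, rfl⟩, ?_⟩, ?_⟩
    · rintro _ ⟨y, hy, rfl⟩
      exact hmax hy
    · have : ENNReal.HolderConjugate ∞ (ENNReal.ofReal 1) := by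
        rw [ENNReal.ofReal_one]; exact ENNReal.HolderConjugate.top_one
      -- At `q = 1` the exponent `(n+1)q - (n+2)` is `-1`, and the power of `x_n` in the coefficient
      -- vanishes.
      have key := isSharpGradientCoeff_of_sphereIntegral ha hx ht (p := ∞) le_rfl
        (by rw [hκ, one_mul]) (by rw [hlam, mul_one]) (by ring) hz hmax
      convert key using 2
      · norm_num [Real.rpow_neg_one]
        ring
      · norm_num
  · exact explicit
  · obtain ⟨-, key⟩ := explicit 2 _ _ _ _ le_rfl (by rw [hnd]; linarith) rfl rfl rfl rfl
    rw [ENNReal.ofReal_ofNat] at key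
    have hint : ∀ θ : ℝ, (∫ ξ in Ioi (x (Fin.last d) ^ 2 / (2 * a ^ 2 * t * Real.cos θ ^ 2)),
            ξ ^ (d + 1) * Real.exp (-ξ)) *
          Real.cos θ ^ (d + 1 + 2) * Real.sin θ ^ (d - 1) =
        (∫ ξ in Ioi ((2 : ℝ) / (2 - 1) * x (Fin.last d) ^ 2 / (4 * a ^ 2 * t * Real.cos θ ^ 2)),
                ξ ^ (((((d + 1 : ℕ) : ℝ) - 2) * 2 + 4) / (2 * (2 - 1))) * Real.exp (-ξ)) *
              Real.cos θ ^ ((((d + 1 : ℕ) : ℝ) + 2) / (2 - 1)) * Real.sin θ ^ (d - 1) := by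
      intro θ
      have e1 : ((((d + 1 : ℕ) : ℝ) - 2) * 2 + 4) / (2 * (2 - 1)) = ((d + 1 : ℕ) : ℝ) := by
        ring
      have e2 : (((d + 1 : ℕ) : ℝ) + 2) / (2 - 1) = ((d + 1 + 2 : ℕ) : ℝ) := by
        push_cast; ring
      have e3 : (2 : ℝ) / (2 - 1) * x (Fin.last d) ^ 2 / (4 * a ^ 2 * t * Real.cos θ ^ 2) =
          x (Fin.last d) ^ 2 / (2 * a ^ 2 * t * Real.cos θ ^ 2) := by
        rw [show (2 : ℝ) / (2 - 1) = 2 by norm_num,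
          show 4 * a ^ 2 * t * Real.cos θ ^ 2 = 2 * (2 * a ^ 2 * t * Real.cos θ ^ 2) by ring,
          mul_div_mul_left _ _ two_ne_zero]
      simp only [e1, e2, e3, Real.rpow_natCast]
    have hsub : d + 1 - 2 = d - 1 := by omega
    simp only [hsub, hint]
    -- The factor `√(2 ω_{n-1})` is split off the root, to be absorbed into `bConst`.
    rw [show ((2 : ℝ) - 1) / 2 = 1 / 2 by norm_num, ← Real.sqrt_eq_rpow,
      Real.sqrt_mul (by unfold sphereArea; positivity)] at key
    rw [bConst_eq hd1 ha]
    convert key using 1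
    ring
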